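/- Let $\Omega\subset\mathbb R^2$ be a compact convex set with nonempty interior and let $1<p<\infty$. Let $\mathcal U_\Omega$ be the class of continuous concave functions $u:\Omega\to\mathbb R$ with $u|_{\partial\Omega}=0$ whose gradient $(u_x,u_y)$ is uniformly bounded over all points of $\operatorname{int}\Omega$ at which it is defined, and put $$K_p(\Omega)=\sup_{u\in\mathcal U_\Omega,\ u\not\equiv 0}\frac{\|u_x\|_{L_p(\Omega)}}{\|u_y\|_{L_p(\Omega)}}\in[0,\infty].$$ A line of support of $\Omega$ is a straight line that meets $\Omega$ and bounds a closed half-plane containing $\Omega$. The tangent cone to $\Omega$ with vertex $\xi\in\partial\Omega$ is the intersection of all closed half-planes that contain $\Omega$ and are bounded by lines of support through $\xi$; the point $\xi$ is singular if more than one line of support passes through it. A straight line is called angular if, for some singular point $\xi\in\partial\Omega$, it meets the tangent cone with vertex $\xi$ only at $\xi$. Then $K_p(\Omega)<\infty$ if and only if both vertical lines of support of $\Omega$ (that is, those parallel to the $y$-axis) are angular. -/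

import Mathlib

open MeasureTheory
open scoped ENNReal

namespace ConcaveGradient

/-- The partial derivative `u_x` in the plane (meaningful where `u` is differentiable). -/
noncomputable def partialX (u : ℝ × ℝ → ℝ) (z : ℝ × ℝ) : ℝ := fderiv ℝ u z (1, 0)

/-- The partial derivative `u_y` in the plane (meaningful where `u` is differentiable). -/
noncomputable def partialY (u : ℝ × ℝ → ℝ) (z : ℝ × ℝ) : ℝ := fderiv ℝ u z (0, 1)

/-- `u` belongs to the class `𝒰_Ω`: continuous and concave on `Ω`, zero on the boundary of `Ω`, with
gradient uniformly bounded over the interior points of `Ω` where it is defined. Only the values of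
`u` on `Ω` matter. -/
structure IsAdmissible (Ω : Set (ℝ × ℝ)) (u : ℝ × ℝ → ℝ) : Prop where
  continuousOn : ContinuousOn u Ω
  concaveOn : ConcaveOn ℝ Ω u
  eq_zero : ∀ z ∈ frontier Ω, u z = 0
  bounded_gradient : ∃ C : ℝ, ∀ z ∈ interior Ω, DifferentiableAt ℝ u z →
    |partialX u z| ≤ C ∧ |partialY u z| ≤ C

/-- The value `K_p(Ω)`, in `[0, ∞]`: the supremum of `‖u_x‖_p / ‖u_y‖_p` over the functions of
the class `𝒰_Ω` that do not vanish identically on `Ω`; the norms are those of `L_p(Ω)`. -/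
noncomputable def K (p : ℝ≥0∞) (Ω : Set (ℝ × ℝ)) : ℝ≥0∞ :=
  ⨆ (u : ℝ × ℝ → ℝ) (_ : IsAdmissible Ω u) (_ : ∃ z ∈ Ω, u z ≠ 0),
    eLpNorm (partialX u) p (volume.restrict Ω) / eLpNorm (partialY u) p (volume.restrict Ω)

/-- The dot product of the plane. -/
def dot (n z : ℝ × ℝ) : ℝ := n.1 * z.1 + n.2 * z.2

/-- The line with normal vector `n` at offset `c` (a line when `n ≠ 0`). -/
def line (n : ℝ × ℝ) (c : ℝ) : Set (ℝ × ℝ) := {z | dot n z = c}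

/-- The closed half-plane with outward normal vector `n`, bounded by `line n c`. -/
def halfPlane (n : ℝ × ℝ) (c : ℝ) : Set (ℝ × ℝ) := {z | dot n z ≤ c}

/-- A straight line of the plane. -/
def IsStraightLine (l : Set (ℝ × ℝ)) : Prop := ∃ n : ℝ × ℝ, n ≠ 0 ∧ ∃ c : ℝ, l = line n c

/-- A line of support of `Ω`: a straight line that meets `Ω` and bounds a closed half-plane
containing `Ω`. -/
def IsSupportLine (Ω l : Set (ℝ × ℝ)) : Prop :=
  ∃ n : ℝ × ℝ, n ≠ 0 ∧ ∃ c : ℝ, l = line n c ∧ Ω ⊆ halfPlane n c ∧ (l ∩ Ω).Nonempty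

/-- The tangent cone to `Ω` with vertex `ξ`: the intersection of all closed half-planes containing
`Ω` and bounded by lines of support through `ξ`. -/
def tangentCone (Ω : Set (ℝ × ℝ)) (ξ : ℝ × ℝ) : Set (ℝ × ℝ) :=
  {z | ∀ (n : ℝ × ℝ) (c : ℝ), n ≠ 0 → IsSupportLine Ω (line n c) → ξ ∈ line n c →
    Ω ⊆ halfPlane n c → z ∈ halfPlane n c}

/-- A singular boundary point: more than one line of support passes through it. -/
def IsSingularPoint (Ω : Set (ℝ × ℝ)) (ξ : ℝ × ℝ) : Prop :=
  ξ ∈ frontier Ω ∧ {l : Set (ℝ × ℝ) | IsSupportLine Ω l ∧ ξ ∈ l}.Nontrivial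

/-- An angular line: a straight line that meets the tangent cone at some singular boundary point
exactly in the vertex of that cone. -/
def IsAngular (Ω l : Set (ℝ × ℝ)) : Prop :=
  IsStraightLine l ∧ ∃ ξ : ℝ × ℝ, IsSingularPoint Ω ξ ∧ l ∩ tangentCone Ω ξ = {ξ}

/-- The vertical line `x = a`. -/
def verticalLine (a : ℝ) : Set (ℝ × ℝ) := {z | z.1 = a}

end ConcaveGradient

namespace ConcaveGradient

/-! Sufficiency. Angular vertical support lines `x = a` and `x = b` confine `Ω` to cones of slope
`M` with vertices on its boundary (`IsAngular.exists_cone`). Testing the supergradient of `u` at `z`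
against the two vertices, where `u` vanishes, gives `|u_x| ≤ |u| / d + M |u_y|`, with `d` the
distance to the nearer vertical line (`abs_partialX_le`). The vertical section through `z` has
length at most `2 M d`, so a one-dimensional Poincaré inequality on sections yields `‖u / d‖ ≤ 2 M
‖u_y‖`; hence `K ≤ 3 M` (`K_lt_top_of_cones`).

Necessity. For small `κ > 0`, split the half-planes containing `Ω` into those whose normals are
within slope `κ` of pointing left and the rest, with lower envelopes `w` and `v`. The test function
`min v (L w)` has `u_x ≥ L` and `|u_y| ≤ L κ` on the region `E` where `L w < v`, and `|u_y| ≤ 2`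
elsewhere. If `v` is positive at some boundary point, then `|E| ≥ c / L` for large `L`
(`exists_le_volume_steepRegion`). With `K κ ≤ 1/2`, finiteness of `K` bounds `L |E|^(1/p)`, hence
`L^(1 - 1/p)`, which is absurd for `p > 1`. So `v` is positive nowhere on the boundary. The cone of
slopes `±κ⁻¹` circumscribed on the left has a vertex with `v ≥ 0`; were it outside `Ω`, concavity
would make `v` positive where the segment from an interior point to it crosses the boundary. The
vertex thus lies in `Ω`, and the vertical line through it is angular. The right end follows by
reflection. -/

/-! ### Half-planes, cones and angular lines. -/

lemma dot_sub (n z w : ℝ × ℝ) : dot n (z - w) = dot n z - dot n w := by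
  simp [dot]; ring

lemma dot_add (n z w : ℝ × ℝ) : dot n (z + w) = dot n z + dot n w := by
  simp [dot]; ring

lemma dot_smul (n : ℝ × ℝ) (t : ℝ) (z : ℝ × ℝ) : dot n (t • z) = t * dot n z := by
  simp [dot]; ring

lemma smul_dot (n : ℝ × ℝ) (t : ℝ) (z : ℝ × ℝ) : dot (t • n) z = t * dot n z := by
  simp [dot]; ring

lemma continuous_dot (n : ℝ × ℝ) : Continuous (dot n) := by
  unfold dot; fun_prop

lemma abs_dot_le (n z : ℝ × ℝ) : |dot n z| ≤ 2 * ‖n‖ * ‖z‖ := by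
  have h1 : |n.1| * |z.1| ≤ ‖n‖ * ‖z‖ :=
    mul_le_mul (norm_fst_le n) (norm_fst_le z) (abs_nonneg _) (norm_nonneg _)
  have h2 : |n.2| * |z.2| ≤ ‖n‖ * ‖z‖ :=
    mul_le_mul (norm_snd_le n) (norm_snd_le z) (abs_nonneg _) (norm_nonneg _)
  calc |dot n z| ≤ |n.1 * z.1| + |n.2 * z.2| := abs_add_le _ _
    _ ≤ 2 * ‖n‖ * ‖z‖ := by rw [abs_mul, abs_mul]; linarith

/-- Continuous linear functionals on the plane are dot products. -/
lemma exists_dot_eq (f : (ℝ × ℝ) →L[ℝ] ℝ) : ∃ n : ℝ × ℝ, ∀ z, f z = dot n z := by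
  refine ⟨(f (1, 0), f (0, 1)), fun z => ?_⟩
  have : z = z.1 • ((1, 0) : ℝ × ℝ) + z.2 • ((0, 1) : ℝ × ℝ) := by ext <;> simp
  conv_lhs => rw [this]
  simp only [map_add, map_smul, dot, smul_eq_mul]
  ring

/-- A point outside the interior of a convex body is weakly separated from it. -/
lemma exists_supporting_normal {Ω : Set (ℝ × ℝ)} (hconv : Convex ℝ Ω)
    (hint : (interior Ω).Nonempty) {z : ℝ × ℝ} (hz : z ∉ interior Ω) :
    ∃ n : ℝ × ℝ, n ≠ 0 ∧ Ω ⊆ halfPlane n (dot n z) := by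
  obtain ⟨f, hf⟩ := geometric_hahn_banach_open_point hconv.interior isOpen_interior hz
  obtain ⟨n, hn⟩ := exists_dot_eq f
  refine ⟨n, ?_, fun w hw => ?_⟩
  · rintro rfl
    obtain ⟨w, hw⟩ := hint
    have := hf w hw
    simp [hn, dot] at this
  · have h1 : w ∈ closure (interior Ω) := by
      rw [hconv.closure_interior_eq_closure_of_nonempty_interior hint]
      exact subset_closure hw
    have h2 : closure (interior Ω) ⊆ halfPlane n (dot n z) :=
      closure_minimal (fun y hy => by have := hf y hy; rw [hn, hn] at this; exact this.le)
        (isClosed_le (continuous_dot n) continuous_const)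
    exact h2 h1

/-- A point outside a closed convex set is strictly separated from it. -/
lemma exists_separating_normal {Ω : Set (ℝ × ℝ)} (hconv : Convex ℝ Ω)
    (hclosed : IsClosed Ω) (hne : Ω.Nonempty) {z : ℝ × ℝ} (hz : z ∉ Ω) :
    ∃ (n : ℝ × ℝ) (c : ℝ), n ≠ 0 ∧ Ω ⊆ halfPlane n c ∧ c < dot n z := by
  obtain ⟨f, c, hf, hc⟩ := geometric_hahn_banach_closed_point hconv hclosed hz
  obtain ⟨n, hn⟩ := exists_dot_eq f
  refine ⟨n, c, ?_, fun w hw => ?_, by rw [← hn]; exact hc⟩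
  · rintro rfl
    obtain ⟨w, hw⟩ := hne
    have := (hf w hw).trans hc
    simp [hn, dot] at this
  · have := hf w hw
    rw [hn] at this
    exact this.le

/-- An angular vertical line confines the set to a double cone with vertex on the boundary. -/
lemma IsAngular.exists_cone {Ω : Set (ℝ × ℝ)} {a : ℝ}
    (h : IsAngular Ω (verticalLine a)) :
    ∃ M : ℝ, 0 ≤ M ∧ ∃ η : ℝ, (a, η) ∈ frontier Ω ∧ ∀ z ∈ Ω, |z.2 - η| ≤ M * |z.1 - a| := by
  obtain ⟨-, ⟨ξ₁, η⟩, ⟨hξ, -⟩, hcap⟩ := h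
  have hmem : ((ξ₁, η) : ℝ × ℝ) ∈ verticalLine a ∩ tangentCone Ω (ξ₁, η) := by
    rw [hcap]; rfl
  obtain rfl : ξ₁ = a := hmem.1
  -- The point at height `σ` above the vertex is off the tangent cone, so a supporting half-plane
  -- through the vertex excludes it. Its boundary is not vertical and bounds `Ω` on the side of `σ`.
  have key : ∀ σ : ℝ, σ ≠ 0 → ∃ m : ℝ, ∀ z ∈ Ω, σ * (z.2 - η) ≤ m * |z.1 - ξ₁| := by
    intro σ hσ
    have h1 : ((ξ₁, η + σ) : ℝ × ℝ) ∉ tangentCone Ω (ξ₁, η) := by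
      intro hc
      have : ((ξ₁, η + σ) : ℝ × ℝ) ∈ verticalLine ξ₁ ∩ tangentCone Ω (ξ₁, η) := ⟨rfl, hc⟩
      rw [hcap] at this
      simp at this
      exact hσ this
    simp only [tangentCone, Set.mem_ofPred_eq, not_forall] at h1
    obtain ⟨n, c, hn, -, hξc, hΩ, hout⟩ := h1
    simp only [halfPlane, line, dot, Set.mem_ofPred_eq, not_le] at hξc hout
    have hpos : 0 < n.2 * σ := by linarith
    refine ⟨|n.1| * |σ| / |n.2|, fun z hz => ?_⟩
    have hz' : n.1 * z.1 + n.2 * z.2 ≤ c := hΩ hz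
    have h2 : n.2 * (z.2 - η) ≤ |n.1| * |z.1 - ξ₁| := by
      rw [← abs_mul]
      have := neg_abs_le (n.1 * (z.1 - ξ₁))
      linarith
    have hn2 : n.2 ≠ 0 := by rintro h0; simp [h0] at hpos
    have hn2' : 0 < |n.2| := abs_pos.2 hn2
    have hσ2 : |n.2| * σ = n.2 * |σ| := by
      rcases pos_and_pos_or_neg_and_neg_of_mul_pos hpos with ⟨h3, h4⟩ | ⟨h3, h4⟩
      · rw [abs_of_pos h3, abs_of_pos h4]
      · rw [abs_of_neg h3, abs_of_neg h4]; ring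
    rw [div_mul_eq_mul_div, le_div_iff₀ hn2']
    calc σ * (z.2 - η) * |n.2| = |σ| * (n.2 * (z.2 - η)) := by
          linear_combination (z.2 - η) * hσ2
      _ ≤ |σ| * (|n.1| * |z.1 - ξ₁|) := mul_le_mul_of_nonneg_left h2 (abs_nonneg _)
      _ = |n.1| * |σ| * |z.1 - ξ₁| := by ring
  obtain ⟨m₁, h₁⟩ := key 1 one_ne_zero
  obtain ⟨m₂, h₂⟩ := key (-1) (by norm_num)
  refine ⟨max 0 (max m₁ m₂), le_max_left _ _, η, hξ, fun z hz => ?_⟩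
  have e1 := h₁ z hz
  have e2 := h₂ z hz
  have h3 : m₁ * |z.1 - ξ₁| ≤ max 0 (max m₁ m₂) * |z.1 - ξ₁| :=
    mul_le_mul_of_nonneg_right ((le_max_left _ _).trans (le_max_right _ _)) (abs_nonneg _)
  have h4 : m₂ * |z.1 - ξ₁| ≤ max 0 (max m₁ m₂) * |z.1 - ξ₁| :=
    mul_le_mul_of_nonneg_right ((le_max_right _ _).trans (le_max_right _ _)) (abs_nonneg _)
  rw [abs_le]
  constructor <;> linarith

/-- A vertical line through the vertex of a cone that contains the set and opens to the side `σ`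
is angular. -/
lemma isAngular_of_cone {Ω : Set (ℝ × ℝ)} {M σ a η : ℝ} (hM : 0 < M) (hσ : σ ≠ 0)
    (hmem : (a, η) ∈ Ω) (hcone : ∀ z ∈ Ω, |z.2 - η| ≤ M * (σ * (z.1 - a))) :
    IsAngular Ω (verticalLine a) := by
  have hσM : M * σ ≠ 0 := mul_ne_zero hM.ne' hσ
  have hup : Ω ⊆ halfPlane (-(M * σ), 1) (-(M * σ) * a + η) := fun z hz => by
    have := (abs_le.1 (hcone z hz)).2
    simp only [halfPlane, dot, Set.mem_ofPred_eq]; linarith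
  have hdown : Ω ⊆ halfPlane (-(M * σ), -1) (-(M * σ) * a - η) := fun z hz => by
    have := (abs_le.1 (hcone z hz)).1
    simp only [halfPlane, dot, Set.mem_ofPred_eq]; linarith
  have nup : ((-(M * σ), 1) : ℝ × ℝ) ≠ 0 := by simp
  have ndown : ((-(M * σ), -1) : ℝ × ℝ) ≠ 0 := by simp
  have lup : ((a, η) : ℝ × ℝ) ∈ line (-(M * σ), 1) (-(M * σ) * a + η) := by
    simp [line, dot]
  have ldown : ((a, η) : ℝ × ℝ) ∈ line (-(M * σ), -1) (-(M * σ) * a - η) := by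
    simp only [line, dot, Set.mem_ofPred_eq]; ring
  have sup : IsSupportLine Ω (line (-(M * σ), 1) (-(M * σ) * a + η)) :=
    ⟨_, nup, _, rfl, hup, _, lup, hmem⟩
  have sdown : IsSupportLine Ω (line (-(M * σ), -1) (-(M * σ) * a - η)) :=
    ⟨_, ndown, _, rfl, hdown, _, ldown, hmem⟩
  refine ⟨⟨(1, 0), by simp, a, ?_⟩, (a, η), ⟨⟨subset_closure hmem, fun hi => ?_⟩, ?_⟩, ?_⟩
  · ext z; simp [verticalLine, line, dot]
  -- Were the vertex interior, points just above it would lie in `Ω`, against the cone condition.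
  · have hcont : Filter.Tendsto (fun t : ℝ => ((a, η + t) : ℝ × ℝ)) (nhdsWithin 0 (Set.Ioi 0))
        (nhds (a, η)) := by
      have : Continuous (fun t : ℝ => ((a, η + t) : ℝ × ℝ)) := by fun_prop
      have h := this.tendsto 0
      simp only [add_zero] at h
      exact h.mono_left nhdsWithin_le_nhds
    obtain ⟨t, ht, ht0⟩ := ((hcont.eventually (mem_interior_iff_mem_nhds.1 hi)).and
      self_mem_nhdsWithin).exists
    have := hcone _ ht
    simp at this
    exact (ne_of_gt ht0) this
  · refine ⟨_, ⟨sup, lup⟩, _, ⟨sdown, ldown⟩, fun heq => ?_⟩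
    have : ((a + 1, η + M * σ) : ℝ × ℝ) ∈ line (-(M * σ), 1) (-(M * σ) * a + η) := by
      simp only [line, dot, Set.mem_ofPred_eq]; ring
    rw [heq] at this
    simp only [line, dot, Set.mem_ofPred_eq] at this
    apply hσM; linarith
  · refine Set.Subset.antisymm ?_ ?_
    · rintro ⟨x, y⟩ ⟨hx, hy⟩
      obtain rfl : x = a := hx
      have h1 := hy _ _ nup sup lup hup
      have h2 := hy _ _ ndown sdown ldown hdown
      simp only [halfPlane, dot, Set.mem_ofPred_eq] at h1 h2
      have : y = η := by linarith
      simp [this]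
    · rintro _ rfl
      refine ⟨rfl, fun n c _ _ h _ => ?_⟩
      exact le_of_eq h

/-- A vertical line of support passes through a point of the set and leaves the set on one side. -/
lemma IsSupportLine.side {Ω : Set (ℝ × ℝ)} {a : ℝ} (h : IsSupportLine Ω (verticalLine a)) :
    (∃ z ∈ Ω, z.1 = a) ∧ ((∀ z ∈ Ω, a ≤ z.1) ∨ ∀ z ∈ Ω, z.1 ≤ a) := by
  obtain ⟨n, hn, c, hl, hΩ, z, hz, hzΩ⟩ := h
  refine ⟨⟨z, hzΩ, hz⟩, ?_⟩
  have h0 : ((a, 0) : ℝ × ℝ) ∈ line n c := hl ▸ (rfl : ((a, 0) : ℝ × ℝ).1 = a)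
  have h1 : ((a, 1) : ℝ × ℝ) ∈ line n c := hl ▸ (rfl : ((a, 1) : ℝ × ℝ).1 = a)
  simp only [line, dot, Set.mem_ofPred_eq, mul_zero, add_zero, mul_one] at h0 h1
  have hn2 : n.2 = 0 := by linarith
  have hn1 : n.1 ≠ 0 := fun h => hn (Prod.ext h hn2)
  rcases hn1.lt_or_gt with hneg | hpos
  · left
    intro w hw
    have : dot n w ≤ c := hΩ hw
    simp only [dot, hn2, zero_mul, add_zero] at this
    nlinarith
  · right
    intro w hw
    have : dot n w ≤ c := hΩ hw
    simp only [dot, hn2, zero_mul, add_zero] at this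
    nlinarith

lemma isSupportLine_verticalLine {Ω : Set (ℝ × ℝ)} {a σ : ℝ} (hσ : σ ≠ 0)
    (hside : ∀ z ∈ Ω, σ * z.1 ≤ σ * a) (hmem : ∃ z ∈ Ω, z.1 = a) :
    IsSupportLine Ω (verticalLine a) := by
  refine ⟨(σ, 0), by simp [hσ], σ * a, ?_, fun z hz => ?_, ?_⟩
  · ext z; simp [verticalLine, line, dot, hσ]
  · simpa [halfPlane, dot] using hside z hz
  · obtain ⟨z, hz, hza⟩ := hmem
    exact ⟨z, hza, hz⟩

/-! ### Differentiability of concave functions. -/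

open Filter Topology Set

/-- A one-sided lower bound on difference quotients passes to the directional derivative. -/
lemma le_fderiv_of_eventually {φ : ℝ × ℝ → ℝ} {z e : ℝ × ℝ} {k : ℝ}
    (hd : DifferentiableAt ℝ φ z) (hk : ∀ᶠ t in 𝓝[>] (0 : ℝ), φ z + t * k ≤ φ (z + t • e)) :
    k ≤ fderiv ℝ φ z e := by
  have h1 : HasDerivAt (fun t : ℝ => φ (z + t • e)) (fderiv ℝ φ z e) 0 :=
    (hd.hasFDerivAt.hasLineDerivAt e)
  refine ge_of_tendsto h1.tendsto_slope_zero_right ?_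
  filter_upwards [hk, self_mem_nhdsWithin] with t ht ht0
  have ht0' : 0 < t := ht0
  simp only [zero_add, zero_smul, add_zero, smul_eq_mul]
  rw [inv_mul_eq_div, le_div_iff₀ ht0']
  linarith

/-- The derivative of a concave function is a supergradient. -/
lemma _root_.ConcaveOn.sub_le_fderiv {Ω : Set (ℝ × ℝ)} {u : ℝ × ℝ → ℝ} (hu : ConcaveOn ℝ Ω u)
    {z w : ℝ × ℝ} (hz : z ∈ Ω) (hw : w ∈ Ω) (hd : DifferentiableAt ℝ u z) :
    u w - u z ≤ fderiv ℝ u z (w - z) := by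
  refine le_fderiv_of_eventually hd ?_
  filter_upwards [Ioo_mem_nhdsGT (zero_lt_one' ℝ)] with t ht
  have h := hu.2 hz hw (sub_nonneg.2 ht.2.le) ht.1.le (by ring)
  have e : z + t • (w - z) = (1 - t) • z + t • w := by module
  rw [e]
  simp only [smul_eq_mul] at h
  linarith

lemma fderiv_eq_partial (u : ℝ × ℝ → ℝ) (z e : ℝ × ℝ) :
    fderiv ℝ u z e = partialX u z * e.1 + partialY u z * e.2 := by
  have : e = e.1 • ((1, 0) : ℝ × ℝ) + e.2 • ((0, 1) : ℝ × ℝ) := by ext <;> simp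
  conv_lhs => rw [this]
  simp only [map_add, map_smul, partialX, partialY, smul_eq_mul]
  ring

/-- Concave functions are locally Lipschitz in the interior, so Rademacher's theorem applies near
each interior point, and a locally null set is null. -/
lemma _root_.ConcaveOn.ae_differentiableAt {Ω : Set (ℝ × ℝ)} {u : ℝ × ℝ → ℝ}
    (hu : ConcaveOn ℝ Ω u) : ∀ᵐ z : ℝ × ℝ, z ∈ interior Ω → DifferentiableAt ℝ u z := by
  have hl := hu.locallyLipschitzOn_interior
  rw [ae_iff]
  refine measure_null_of_locally_null _ fun z hz => ?_
  simp only [Classical.not_imp, mem_ofPred_eq] at hz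
  obtain ⟨C, t, ht, hLip⟩ := hl hz.1
  rw [isOpen_interior.nhdsWithin_eq hz.1] at ht
  obtain ⟨V, hVt, hV, hzV⟩ := mem_nhds_iff.1 ht
  have h := (hLip.mono hVt).ae_differentiableWithinAt_of_mem (μ := volume)
  refine ⟨_ ∩ V, inter_mem_nhdsWithin _ (hV.mem_nhds hzV), ?_⟩
  refine measure_mono_null ?_ (ae_iff.1 h)
  rintro w ⟨hw, hwV⟩ hcon
  simp only [Classical.not_imp, mem_ofPred_eq] at hw
  exact hw.2 ((hcon hwV).differentiableAt (hV.mem_nhds hwV))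

/-! ### Poincaré inequality on vertical sections. -/

/-- On an interior vertical segment the increment of a concave function is at most the integral of
its vertical derivative. -/
lemma enorm_sub_le_lintegral_partialY {Ω : Set (ℝ × ℝ)} {u : ℝ × ℝ → ℝ}
    (hu : ConcaveOn ℝ Ω u) {x s t : ℝ} (hst : s ≤ t)
    (hsub : ∀ r ∈ Icc s t, (x, r) ∈ interior Ω)
    (hdiff : ∀ᵐ r : ℝ, (x, r) ∈ interior Ω → DifferentiableAt ℝ u (x, r)) :
    ‖u (x, t) - u (x, s)‖ₑ ≤ ∫⁻ r in {r | (x, r) ∈ interior Ω}, ‖partialY u (x, r)‖ₑ := by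
  have hcont : Continuous fun r : ℝ => ((x, r) : ℝ × ℝ) := by fun_prop
  have hloc : LocallyLipschitzOn (Icc s t) fun r => u (x, r) := by
    intro r hr
    obtain ⟨C, V, hV, hLip⟩ := hu.locallyLipschitzOn_interior (hsub r hr)
    rw [isOpen_interior.nhdsWithin_eq (hsub r hr)] at hV
    refine ⟨C, _, mem_nhdsWithin_of_mem_nhds (hcont.continuousAt.preimage_mem_nhds hV), ?_⟩
    intro r₁ h₁ r₂ h₂
    have := hLip h₁ h₂
    simpa [Prod.edist_eq] using this
  obtain ⟨C, hC⟩ := hloc.exists_lipschitzOnWith_of_compact isCompact_Icc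
  rw [← uIcc_of_le hst] at hC
  have hac := hC.absolutelyContinuousOnInterval
  rw [← hac.integral_deriv_eq_sub, intervalIntegral.integral_of_le hst]
  refine (enorm_integral_le_lintegral_enorm _).trans ?_
  have hsub' : Ioc s t ⊆ {r | (x, r) ∈ interior Ω} := fun r hr => hsub r ⟨hr.1.le, hr.2⟩
  refine le_trans (lintegral_mono_ae ?_) (lintegral_mono_set hsub')
  rw [ae_restrict_iff' measurableSet_Ioc]
  filter_upwards [hdiff] with r hr hrI
  have hd := hr (hsub' hrI)
  have h1 : HasDerivAt (fun r : ℝ => ((x, r) : ℝ × ℝ)) (0, 1) r :=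
    (hasDerivAt_const r x).prodMk (hasDerivAt_id r)
  have h2 := hd.hasFDerivAt.comp_hasDerivAt r h1
  rw [show deriv (fun r => u (x, r)) r = partialY u (x, r) from h2.deriv]

/-- The lowest point of the section is a boundary point, where `u = 0`. Local Lipschitz continuity
is used only in the interior, so the increment is estimated from heights `r > s` and `r` tends to
`s` by continuity of `u` on `Ω`. -/
lemma enorm_le_lintegral_partialY {Ω : Set (ℝ × ℝ)} {u : ℝ × ℝ → ℝ} (hconv : Convex ℝ Ω)
    (hcomp : IsCompact Ω) (hcont : ContinuousOn u Ω) (hu : ConcaveOn ℝ Ω u)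
    (hzero : ∀ z ∈ frontier Ω, u z = 0) {x y : ℝ} (hy : (x, y) ∈ interior Ω)
    (hdiff : ∀ᵐ r : ℝ, (x, r) ∈ interior Ω → DifferentiableAt ℝ u (x, r)) :
    ‖u (x, y)‖ₑ ≤ ∫⁻ r in {r | (x, r) ∈ interior Ω}, ‖partialY u (x, r)‖ₑ := by
  have hι : Continuous fun r : ℝ => ((x, r) : ℝ × ℝ) := by fun_prop
  set T : Set ℝ := {r | (x, r) ∈ Ω} with hT
  have hyT : y ∈ T := (interior_subset hy : (x, y) ∈ Ω)
  have hTclosed : IsClosed T := hcomp.isClosed.preimage hι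
  have hTbdd : BddBelow T := by
    obtain ⟨R, hR⟩ := hcomp.isBounded.exists_norm_le
    refine ⟨-R, fun r hr => ?_⟩
    have h1 := (norm_snd_le ((x, r) : ℝ × ℝ)).trans (hR _ hr)
    exact (abs_le.1 h1).1
  have hsT : sInf T ∈ T := hTclosed.csInf_mem ⟨y, hyT⟩ hTbdd
  set s := sInf T with hs
  have hsint : (x, s) ∉ interior Ω := by
    intro hi
    have h1 : {r : ℝ | (x, r) ∈ interior Ω} ∈ 𝓝 s :=
      (isOpen_interior.preimage hι).mem_nhds hi
    have h2 : ∀ᶠ r in 𝓝[<] s, (x, r) ∈ interior Ω := mem_nhdsWithin_of_mem_nhds h1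
    obtain ⟨r, hr, hrs⟩ := (h2.and self_mem_nhdsWithin).exists
    exact absurd (csInf_le hTbdd (interior_subset hr : (x, r) ∈ Ω)) (not_le.2 hrs)
  have hs0 : u (x, s) = 0 := hzero _ ⟨subset_closure hsT, hsint⟩
  have hsy : s < y := lt_of_le_of_ne (csInf_le hTbdd hyT) (fun h => hsint (h ▸ hy))
  have hmem : ∀ r ∈ Ioc s y, (x, r) ∈ interior Ω := by
    intro r hr
    rcases hr.2.eq_or_lt with rfl | hlt
    · exact hy
    · refine hconv.openSegment_interior_self_subset_interior hy hsT ?_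
      refine ⟨(r - s) / (y - s), (y - r) / (y - s), div_pos (sub_pos.2 hr.1) (sub_pos.2 hsy),
        div_pos (sub_pos.2 hlt) (sub_pos.2 hsy), ?_, ?_⟩
      · have := (sub_pos.2 hsy).ne'
        field_simp; ring
      · have := (sub_pos.2 hsy).ne'
        ext
        · simp; field_simp; ring
        · simp; field_simp; ring
  have hlim : Tendsto (fun r => ‖u (x, y) - u (x, r)‖ₑ) (𝓝[>] s) (𝓝 ‖u (x, y)‖ₑ) := by
    have h1 : Tendsto (fun r : ℝ => ((x, r) : ℝ × ℝ)) (𝓝[>] s) (𝓝[Ω] (x, s)) := by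
      refine tendsto_nhdsWithin_iff.2 ⟨(hι.tendsto s).mono_left nhdsWithin_le_nhds, ?_⟩
      filter_upwards [Ioc_mem_nhdsGT hsy] with r hr
      exact interior_subset (hmem r hr)
    have h2 := (hcont _ hsT).tendsto.comp h1
    rw [hs0] at h2
    have h3 := (tendsto_const_nhds (x := u (x, y))).sub h2
    rw [sub_zero] at h3
    exact h3.enorm
  refine le_of_tendsto hlim ?_
  filter_upwards [Ioc_mem_nhdsGT hsy] with r hr
  exact enorm_sub_le_lintegral_partialY hu hr.2
    (fun r' hr' => hmem r' ⟨hr.1.trans_le hr'.1, hr'.2⟩) hdiff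

lemma measurable_partialX (u : ℝ × ℝ → ℝ) : Measurable (partialX u) :=
  measurable_fderiv_apply_const ℝ u _

lemma measurable_partialY (u : ℝ × ℝ → ℝ) : Measurable (partialY u) :=
  measurable_fderiv_apply_const ℝ u _

/-- A function bounded by the `L¹` norm of another one on a set obeys the Poincaré inequality with
the measure of the set as constant. -/
lemma eLpNorm_le_measure_mul_eLpNorm {S : Set ℝ} {f g : ℝ → ℝ} {p : ℝ≥0∞} (hp : 1 ≤ p)
    (hS : MeasurableSet S) (hg : AEStronglyMeasurable g (volume.restrict S))
    (hfg : ∀ y ∈ S, ‖f y‖ₑ ≤ ∫⁻ r in S, ‖g r‖ₑ) :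
    eLpNorm f p (volume.restrict S) ≤ volume S * eLpNorm g p (volume.restrict S) := by
  rcases eq_or_ne (volume S) 0 with h0 | h0
  · have : volume.restrict S = 0 := Measure.restrict_eq_zero.2 h0
    simp [this]
  rcases eq_or_ne (volume S) ∞ with h1 | h1
  · rcases eq_or_ne (eLpNorm g p (volume.restrict S)) 0 with h2 | h2
    · have h3 : g =ᵐ[volume.restrict S] 0 :=
        (eLpNorm_eq_zero_iff hg (by positivity)).1 h2
      have h4 : ∫⁻ r in S, ‖g r‖ₑ = 0 := by
        rw [lintegral_congr_ae (h3.mono fun r hr => by rw [hr])]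
        simp
      have h5 : f =ᵐ[volume.restrict S] 0 := by
        filter_upwards [ae_restrict_mem hS] with y hy
        have := hfg y hy
        rw [h4] at this
        simpa using this
      rw [eLpNorm_congr_ae h5]
      simp
    · rw [h1, ENNReal.top_mul h2]; exact le_top
  -- The exponents `1 / p` here and `1 - 1 / p` from Hölder's inequality add up to one power of the
  -- measure.
  have e1 : eLpNorm f p (volume.restrict S)
      ≤ (∫⁻ r in S, ‖g r‖ₑ) * volume S ^ (1 / p.toReal) := by
    rcases eq_or_ne p ∞ with rfl | hpt
    · simp only [ENNReal.toReal_top, div_zero, ENNReal.rpow_zero, mul_one, eLpNorm_exponent_top]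
      refine essSup_le_of_ae_le _ ?_
      filter_upwards [ae_restrict_mem hS] with y hy using hfg y hy
    · have hp0 : p ≠ 0 := (zero_lt_one.trans_le hp).ne'
      calc eLpNorm f p (volume.restrict S)
          ≤ eLpNorm (fun _ : ℝ => ∫⁻ r in S, ‖g r‖ₑ) p (volume.restrict S) := by
            refine eLpNorm_mono_enorm_ae ?_
            filter_upwards [ae_restrict_mem hS] with y hy
            simpa using hfg y hy
        _ = _ := by
            rw [eLpNorm_const' _ hp0 hpt]
            simp
  have e2 : ∫⁻ r in S, ‖g r‖ₑ
      ≤ eLpNorm g p (volume.restrict S) * volume S ^ (1 - 1 / p.toReal) := by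
    have h := eLpNorm_le_eLpNorm_mul_rpow_measure_univ hp hg
    rw [eLpNorm_one_eq_lintegral_enorm] at h
    simpa using h
  calc eLpNorm f p (volume.restrict S)
      ≤ eLpNorm g p (volume.restrict S) * volume S ^ (1 - 1 / p.toReal)
          * volume S ^ (1 / p.toReal) := e1.trans (mul_le_mul_left e2 _)
    _ = volume S * eLpNorm g p (volume.restrict S) := by
        rw [mul_assoc, ← ENNReal.rpow_add _ _ h0 h1, sub_add_cancel, ENNReal.rpow_one, mul_comm]

lemma lintegral_restrict_eq_lintegral_sections {A : Set (ℝ × ℝ)} (hA : MeasurableSet A)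
    {F : ℝ × ℝ → ℝ≥0∞} (hF : AEMeasurable F (volume.restrict A)) :
    ∫⁻ z in A, F z = ∫⁻ x : ℝ, ∫⁻ y in {y | (x, y) ∈ A}, F (x, y) := by
  rw [← lintegral_indicator hA, Measure.volume_eq_prod, lintegral_prod]
  · refine lintegral_congr fun x => ?_
    have hS : MeasurableSet {y | (x, y) ∈ A} := measurable_prodMk_left hA
    rw [← lintegral_indicator hS]
    rfl
  · rw [← Measure.volume_eq_prod]
    exact (aemeasurable_indicator_iff hA).2 hF

/-- Inequalities between `Lᵖ` norms on vertical sections integrate to the whole set. -/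
lemma eLpNorm_le_of_sections {A : Set (ℝ × ℝ)} (hA : MeasurableSet A) {f g : ℝ × ℝ → ℝ}
    (hf : AEStronglyMeasurable f (volume.restrict A))
    (hg : AEStronglyMeasurable g (volume.restrict A)) {p C : ℝ≥0∞} (hp0 : p ≠ 0) (hpt : p ≠ ∞)
    (hC : C ≠ ∞)
    (hfg : ∀ᵐ x : ℝ, eLpNorm (fun y => f (x, y)) p (volume.restrict {y | (x, y) ∈ A})
      ≤ C * eLpNorm (fun y => g (x, y)) p (volume.restrict {y | (x, y) ∈ A})) :
    eLpNorm f p (volume.restrict A) ≤ C * eLpNorm g p (volume.restrict A) := by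
  have hpos : 0 < p.toReal := ENNReal.toReal_pos hp0 hpt
  have hpow : ∀ (h : ℝ × ℝ → ℝ) (_ : AEStronglyMeasurable h (volume.restrict A)),
      eLpNorm h p (volume.restrict A) ^ p.toReal = ∫⁻ x : ℝ,
        eLpNorm (fun y => h (x, y)) p (volume.restrict {y | (x, y) ∈ A}) ^ p.toReal := by
    intro h hh
    rw [eLpNorm_eq_lintegral_rpow_enorm_toReal hp0 hpt, ← ENNReal.rpow_mul,
      one_div_mul_cancel hpos.ne', ENNReal.rpow_one,
      lintegral_restrict_eq_lintegral_sections hA (hh.enorm.pow_const _)]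
    refine lintegral_congr fun x => ?_
    rw [eLpNorm_eq_lintegral_rpow_enorm_toReal hp0 hpt, ← ENNReal.rpow_mul,
      one_div_mul_cancel hpos.ne', ENNReal.rpow_one]
  rw [← ENNReal.rpow_le_rpow_iff hpos, ENNReal.mul_rpow_of_nonneg _ _ hpos.le, hpow f hf,
    hpow g hg]
  rw [← lintegral_const_mul' _ _ (ENNReal.rpow_ne_top_of_nonneg hpos.le hC)]
  refine lintegral_mono_ae ?_
  filter_upwards [hfg] with x hx
  rw [← ENNReal.mul_rpow_of_nonneg _ _ hpos.le]
  exact ENNReal.rpow_le_rpow hx hpos.le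

/-! ### Sufficiency: conical ends make `K` finite. -/

/-- The distance to the nearer of the vertical lines `x = a` and `x = b`, between them. -/
noncomputable def edgeDist (a b : ℝ) (z : ℝ × ℝ) : ℝ := min (z.1 - a) (b - z.1)

lemma fst_ne_of_cone {Ω : Set (ℝ × ℝ)} {a η M : ℝ} (hfr : (a, η) ∈ frontier Ω)
    (hcone : ∀ z ∈ Ω, |z.2 - η| ≤ M * |z.1 - a|) {z : ℝ × ℝ} (hz : z ∈ interior Ω) :
    z.1 ≠ a := by
  rintro rfl
  have h := hcone z (interior_subset hz)
  simp only [sub_self, abs_zero, mul_zero] at h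
  have h2 : z.2 = η := by
    have := abs_nonpos_iff.1 h
    linarith
  exact hfr.2 (by rw [← h2]; exact hz)

/-- The supergradient inequality against a boundary point bounds the horizontal derivative. -/
lemma mul_partialX_le {Ω : Set (ℝ × ℝ)} {u : ℝ × ℝ → ℝ} (hclosed : IsClosed Ω)
    (hu : ConcaveOn ℝ Ω u) (hzero : ∀ z ∈ frontier Ω, u z = 0) {a η M : ℝ}
    (hfr : (a, η) ∈ frontier Ω) (hcone : ∀ z ∈ Ω, |z.2 - η| ≤ M * |z.1 - a|)
    {z : ℝ × ℝ} (hz : z ∈ interior Ω) (hd : DifferentiableAt ℝ u z) :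
    partialX u z * (z.1 - a) ≤ |u z| + M * |z.1 - a| * |partialY u z| := by
  have h1 := hu.sub_le_fderiv (interior_subset hz) (hclosed.frontier_subset hfr) hd
  rw [hzero _ hfr, fderiv_eq_partial] at h1
  simp only [Prod.fst_sub, Prod.snd_sub] at h1
  have h2 : -(partialY u z * (z.2 - η)) ≤ M * |z.1 - a| * |partialY u z| := by
    calc -(partialY u z * (z.2 - η)) ≤ |partialY u z * (z.2 - η)| := neg_le_abs _
      _ = |z.2 - η| * |partialY u z| := by rw [abs_mul, mul_comm]
      _ ≤ _ := mul_le_mul_of_nonneg_right (hcone z (interior_subset hz)) (abs_nonneg _)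
  have h3 := le_abs_self (u z)
  linarith

section

variable {Ω : Set (ℝ × ℝ)} {a b η θ M : ℝ}

lemma edgeDist_pos (ha : ∀ z ∈ Ω, a ≤ z.1) (hb : ∀ z ∈ Ω, z.1 ≤ b)
    (hfa : (a, η) ∈ frontier Ω) (hca : ∀ z ∈ Ω, |z.2 - η| ≤ M * |z.1 - a|)
    (hfb : (b, θ) ∈ frontier Ω) (hcb : ∀ z ∈ Ω, |z.2 - θ| ≤ M * |z.1 - b|)
    {z : ℝ × ℝ} (hz : z ∈ interior Ω) : 0 < edgeDist a b z :=
  lt_min (sub_pos.2 (lt_of_le_of_ne (ha z (interior_subset hz)) (fst_ne_of_cone hfa hca hz).symm))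
    (sub_pos.2 (lt_of_le_of_ne (hb z (interior_subset hz)) (fst_ne_of_cone hfb hcb hz)))

/-- In a set with conical ends `|u_x| ≤ |u| / d + M |u_y|`. -/
lemma abs_partialX_le {u : ℝ × ℝ → ℝ} (hclosed : IsClosed Ω)
    (ha : ∀ z ∈ Ω, a ≤ z.1) (hb : ∀ z ∈ Ω, z.1 ≤ b)
    (hfa : (a, η) ∈ frontier Ω) (hca : ∀ z ∈ Ω, |z.2 - η| ≤ M * |z.1 - a|)
    (hfb : (b, θ) ∈ frontier Ω) (hcb : ∀ z ∈ Ω, |z.2 - θ| ≤ M * |z.1 - b|)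
    (hu : ConcaveOn ℝ Ω u) (hzero : ∀ z ∈ frontier Ω, u z = 0)
    {z : ℝ × ℝ} (hz : z ∈ interior Ω) (hd : DifferentiableAt ℝ u z) :
    |partialX u z| ≤ (edgeDist a b z)⁻¹ * |u z| + M * |partialY u z| := by
  have hpos := edgeDist_pos ha hb hfa hca hfb hcb hz
  have key : ∀ X ℓ : ℝ, edgeDist a b z ≤ ℓ → X * ℓ ≤ |u z| + M * ℓ * |partialY u z| →
      X ≤ (edgeDist a b z)⁻¹ * |u z| + M * |partialY u z| := by
    intro X ℓ hℓ hX
    have hℓ0 : 0 < ℓ := hpos.trans_le hℓ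
    have h1 : X ≤ ℓ⁻¹ * |u z| + M * |partialY u z| := by
      refine le_of_mul_le_mul_right ?_ hℓ0
      calc X * ℓ ≤ |u z| + M * ℓ * |partialY u z| := hX
        _ = (ℓ⁻¹ * |u z| + M * |partialY u z|) * ℓ := by field_simp
    have h2 : ℓ⁻¹ ≤ (edgeDist a b z)⁻¹ := inv_anti₀ hpos hℓ
    have h3 := mul_le_mul_of_nonneg_right h2 (abs_nonneg (u z))
    linarith
  have hA := ha z (interior_subset hz)
  have hB := hb z (interior_subset hz)
  refine abs_le'.2 ⟨key _ _ (min_le_left _ _) ?_, key _ _ (min_le_right _ _) ?_⟩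
  · have h := mul_partialX_le hclosed hu hzero hfa hca hz hd
    rwa [abs_of_nonneg (sub_nonneg.2 hA)] at h
  · have h := mul_partialX_le hclosed hu hzero hfb hcb hz hd
    rw [abs_of_nonpos (sub_nonpos.2 hB), neg_sub] at h
    linarith

/-- The cone at the nearer end traps the section in an interval of radius `M` times the distance to
that end. -/
lemma volume_section_le (ha : ∀ z ∈ Ω, a ≤ z.1) (hb : ∀ z ∈ Ω, z.1 ≤ b)
    (hca : ∀ z ∈ Ω, |z.2 - η| ≤ M * |z.1 - a|) (hcb : ∀ z ∈ Ω, |z.2 - θ| ≤ M * |z.1 - b|)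
    (x y : ℝ) : volume {y | (x, y) ∈ interior Ω} ≤ ENNReal.ofReal (2 * M * edgeDist a b (x, y)) := by
  have key : ∀ ζ c : ℝ, (∀ r, (x, r) ∈ Ω → |r - ζ| ≤ M * c) →
      volume {y | (x, y) ∈ interior Ω} ≤ ENNReal.ofReal (2 * M * c) := by
    intro ζ c h
    calc volume {y | (x, y) ∈ interior Ω} ≤ volume (Icc (ζ - M * c) (ζ + M * c)) := by
          refine measure_mono fun r hr => ?_
          have := abs_le.1 (h r (interior_subset hr))
          exact ⟨by linarith, by linarith⟩
      _ = ENNReal.ofReal (2 * M * c) := by rw [Real.volume_Icc]; congr 1; ring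
  rcases min_choice (x - a) (b - x) with h | h
  · rw [edgeDist, h]
    refine key η _ fun r hr => ?_
    have := hca _ hr
    rwa [abs_of_nonneg (sub_nonneg.2 (ha _ hr))] at this
  · rw [edgeDist, h]
    refine key θ _ fun r hr => ?_
    have := hcb _ hr
    rwa [abs_of_nonpos (sub_nonpos.2 (hb _ hr)), neg_sub] at this

/-- The weight `d⁻¹` is constant on each vertical section and cancels the `d` in the Poincaré
constant `2 M d`. -/
lemma eLpNorm_edgeDist_inv_mul_le {u : ℝ × ℝ → ℝ} (hconv : Convex ℝ Ω) (hcomp : IsCompact Ω)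
    (ha : ∀ z ∈ Ω, a ≤ z.1) (hb : ∀ z ∈ Ω, z.1 ≤ b)
    (hfa : (a, η) ∈ frontier Ω) (hca : ∀ z ∈ Ω, |z.2 - η| ≤ M * |z.1 - a|)
    (hfb : (b, θ) ∈ frontier Ω) (hcb : ∀ z ∈ Ω, |z.2 - θ| ≤ M * |z.1 - b|)
    (hcont : ContinuousOn u Ω) (hu : ConcaveOn ℝ Ω u) (hzero : ∀ z ∈ frontier Ω, u z = 0)
    {p : ℝ≥0∞} (hp : 1 ≤ p) (hpt : p ≠ ∞) :
    eLpNorm (fun z => (edgeDist a b z)⁻¹ * u z) p (volume.restrict (interior Ω))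
      ≤ ENNReal.ofReal (2 * M) * eLpNorm (partialY u) p (volume.restrict (interior Ω)) := by
  have hmeas : MeasurableSet (interior Ω) := isOpen_interior.measurableSet
  have hD : Measurable (edgeDist a b) := by unfold edgeDist; fun_prop
  refine eLpNorm_le_of_sections hmeas ?_ (measurable_partialY u).aestronglyMeasurable
    (zero_lt_one.trans_le hp).ne' hpt ENNReal.ofReal_ne_top ?_
  · exact hD.inv.aestronglyMeasurable.mul
      ((hcont.mono interior_subset).aestronglyMeasurable hmeas)
  have hae : ∀ᵐ x : ℝ, ∀ᵐ y : ℝ, (x, y) ∈ interior Ω → DifferentiableAt ℝ u (x, y) := by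
    have := hu.ae_differentiableAt
    rw [Measure.volume_eq_prod] at this
    exact Measure.ae_ae_of_ae_prod this
  filter_upwards [hae] with x hx
  have hS : MeasurableSet {y | (x, y) ∈ interior Ω} := measurable_prodMk_left hmeas
  rcases Set.eq_empty_or_nonempty {y | (x, y) ∈ interior Ω} with hE | ⟨y₀, hy₀⟩
  · simp [hE]
  have hpos : 0 < edgeDist a b (x, y₀) := edgeDist_pos ha hb hfa hca hfb hcb hy₀
  set D := edgeDist a b (x, y₀) with hDdef
  have h1 : eLpNorm (fun y => u (x, y)) p (volume.restrict {y | (x, y) ∈ interior Ω})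
      ≤ volume {y | (x, y) ∈ interior Ω} * eLpNorm (fun y => partialY u (x, y)) p
        (volume.restrict {y | (x, y) ∈ interior Ω}) :=
    eLpNorm_le_measure_mul_eLpNorm hp hS
      ((measurable_partialY u).comp measurable_prodMk_left).aestronglyMeasurable
      fun y hy => enorm_le_lintegral_partialY hconv hcomp hcont hu hzero hy hx
  have h2 : (fun y => (edgeDist a b (x, y))⁻¹ * u (x, y)) = D⁻¹ • fun y => u (x, y) := rfl
  rw [h2, eLpNorm_const_smul]
  refine (mul_le_mul_right h1 _).trans ?_
  rw [← mul_assoc]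
  refine mul_le_mul_left ?_ _
  refine (mul_le_mul_right (volume_section_le ha hb hca hcb x y₀) _).trans ?_
  rw [Real.enorm_eq_ofReal (inv_nonneg.2 hpos.le), ← ENNReal.ofReal_mul (inv_nonneg.2 hpos.le)]
  refine ENNReal.ofReal_le_ofReal (le_of_eq ?_)
  rw [← hDdef]
  field_simp

/-- `K_p(Ω)` is finite when `Ω` is conical at both horizontal ends. -/
lemma K_lt_top_of_cones (hconv : Convex ℝ Ω) (hcomp : IsCompact Ω)
    (hM : 0 ≤ M) (ha : ∀ z ∈ Ω, a ≤ z.1) (hb : ∀ z ∈ Ω, z.1 ≤ b)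
    (hfa : (a, η) ∈ frontier Ω) (hca : ∀ z ∈ Ω, |z.2 - η| ≤ M * |z.1 - a|)
    (hfb : (b, θ) ∈ frontier Ω) (hcb : ∀ z ∈ Ω, |z.2 - θ| ≤ M * |z.1 - b|)
    {p : ℝ≥0∞} (hp : 1 ≤ p) (hpt : p ≠ ∞) : K p Ω < ∞ := by
  refine lt_of_le_of_lt (b := ENNReal.ofReal (2 * M) + ENNReal.ofReal M) ?_ (by finiteness)
  refine iSup_le fun u => iSup_le fun hu => iSup_le fun _ => ENNReal.div_le_of_le_mul ?_
  have hres : volume.restrict Ω = volume.restrict (interior Ω) :=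
    Measure.restrict_congr_set
      (interior_ae_eq_of_null_frontier (hconv.addHaar_frontier volume)).symm
  have hmeas : MeasurableSet (interior Ω) := isOpen_interior.measurableSet
  have hD : Measurable (edgeDist a b) := by unfold edgeDist; fun_prop
  rw [hres]
  set μ := volume.restrict (interior Ω) with hμ
  have hum : AEStronglyMeasurable (fun z => (edgeDist a b z)⁻¹ * u z) μ :=
    hD.inv.aestronglyMeasurable.mul
      ((hu.continuousOn.mono interior_subset).aestronglyMeasurable hmeas)
  have hym : AEStronglyMeasurable (partialY u) μ := (measurable_partialY u).aestronglyMeasurable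
  calc eLpNorm (partialX u) p μ
      ≤ eLpNorm ((fun z => ‖(edgeDist a b z)⁻¹ * u z‖) + fun z => M * ‖partialY u z‖) p μ := by
        refine eLpNorm_mono_ae ?_
        rw [hμ]
        filter_upwards [ae_restrict_of_ae hu.concaveOn.ae_differentiableAt,
          ae_restrict_mem hmeas] with z hz hzi
        have h := abs_partialX_le hcomp.isClosed ha hb hfa hca hfb hcb hu.concaveOn hu.eq_zero
          hzi (hz hzi)
        have hpos := edgeDist_pos ha hb hfa hca hfb hcb hzi
        simp only [Pi.add_apply, Real.norm_eq_abs, abs_mul, abs_inv]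
        rw [abs_of_pos hpos]
        exact h.trans (le_abs_self _)
    _ ≤ eLpNorm (fun z => ‖(edgeDist a b z)⁻¹ * u z‖) p μ
        + eLpNorm (fun z => M * ‖partialY u z‖) p μ :=
        eLpNorm_add_le hum.norm (hym.norm.const_mul M) hp
    _ = eLpNorm (fun z => (edgeDist a b z)⁻¹ * u z) p μ
        + ENNReal.ofReal M * eLpNorm (partialY u) p μ := by
        rw [eLpNorm_norm, show (fun z => M * ‖partialY u z‖) = M • fun z => ‖partialY u z‖ from rfl,
          eLpNorm_const_smul, eLpNorm_norm, Real.enorm_eq_ofReal hM]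
    _ ≤ (ENNReal.ofReal (2 * M) + ENNReal.ofReal M) * eLpNorm (partialY u) p μ := by
        rw [add_mul]
        gcongr
        exact eLpNorm_edgeDist_inv_mul_le hconv hcomp ha hb hfa hca hfb hcb hu.continuousOn
          hu.concaveOn hu.eq_zero hp hpt

end

/-! ### Concave envelopes of families of half-planes. -/

/-- The infimum of the affine functions `z ↦ c - n · z` over a family of pairs `(n, c)`. -/
noncomputable def lowerEnvelope (A : Set ((ℝ × ℝ) × ℝ)) (z : ℝ × ℝ) : ℝ :=
  ⨅ i : A, (i.1.2 - dot i.1.1 z)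

/-- A nonempty family of half-planes with normals of norm at most one, all containing `Ω`. -/
structure IsHalfPlaneFamily (Ω : Set (ℝ × ℝ)) (A : Set ((ℝ × ℝ) × ℝ)) : Prop where
  nonempty : A.Nonempty
  subset_halfPlane : ∀ i ∈ A, Ω ⊆ halfPlane i.1 i.2
  norm_le : ∀ i ∈ A, ‖i.1‖ ≤ 1

namespace IsHalfPlaneFamily

variable {Ω : Set (ℝ × ℝ)} {A : Set ((ℝ × ℝ) × ℝ)}

lemma le_lowerEnvelope (hA : IsHalfPlaneFamily Ω A) {z : ℝ × ℝ} {b : ℝ}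
    (h : ∀ i ∈ A, b ≤ i.2 - dot i.1 z) : b ≤ lowerEnvelope A z :=
  haveI := hA.nonempty.to_subtype
  le_ciInf fun i => h i.1 i.2

/-- The infimum is over a set bounded below even when `z` is outside `Ω`: the values are nonnegative
at a point of `Ω`, and normals of norm at most one limit the drop from there to `z`. Otherwise the
real infimum would take its default value. -/
lemma lowerEnvelope_le (hA : IsHalfPlaneFamily Ω A) (hΩ : Ω.Nonempty) {i : (ℝ × ℝ) × ℝ}
    (hi : i ∈ A) (z : ℝ × ℝ) : lowerEnvelope A z ≤ i.2 - dot i.1 z := by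
  obtain ⟨w, hw⟩ := hΩ
  refine ciInf_le ⟨-(2 * ‖w - z‖), ?_⟩ (⟨i, hi⟩ : A)
  rintro _ ⟨⟨j, hj⟩, rfl⟩
  have h1 : dot j.1 w ≤ j.2 := hA.subset_halfPlane j hj hw
  have h2 := neg_le_of_abs_le (abs_dot_le j.1 (w - z))
  have h3 : 2 * ‖j.1‖ * ‖w - z‖ ≤ 2 * 1 * ‖w - z‖ :=
    mul_le_mul_of_nonneg_right (by linarith [hA.norm_le j hj]) (norm_nonneg _)
  rw [dot_sub] at h2
  show -(2 * ‖w - z‖) ≤ j.2 - dot j.1 z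
  linarith

lemma lowerEnvelope_nonneg (hA : IsHalfPlaneFamily Ω A) {z : ℝ × ℝ} (hz : z ∈ Ω) :
    0 ≤ lowerEnvelope A z :=
  hA.le_lowerEnvelope fun i hi => sub_nonneg.2 (hA.subset_halfPlane i hi hz)

/-- A bound on the slopes of the family in a direction bounds the growth of the envelope. -/
lemma lowerEnvelope_add_le (hA : IsHalfPlaneFamily Ω A) (hΩ : Ω.Nonempty) {e : ℝ × ℝ} {k : ℝ}
    (h : ∀ i ∈ A, k ≤ -dot i.1 e) (z : ℝ × ℝ) {t : ℝ} (ht : 0 ≤ t) :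
    lowerEnvelope A z + t * k ≤ lowerEnvelope A (z + t • e) := by
  refine hA.le_lowerEnvelope fun i hi => ?_
  have h1 := hA.lowerEnvelope_le hΩ hi z
  have h2 := mul_le_mul_of_nonneg_left (h i hi) ht
  rw [dot_add, dot_smul]
  linarith

/-- The constant is `2` because the plane carries the maximum norm, for which the dot product with a
unit normal has norm up to `2`. -/
lemma lipschitzWith (hA : IsHalfPlaneFamily Ω A) (hΩ : Ω.Nonempty) :
    LipschitzWith 2 (lowerEnvelope A) := by
  refine LipschitzWith.of_le_add_mul _ fun z w => ?_
  have h := hA.lowerEnvelope_add_le hΩ (e := w - z) (k := -(2 * ‖w - z‖)) (fun i hi => ?_) z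
    zero_le_one
  · rw [one_smul, add_sub_cancel, one_mul] at h
    rw [dist_comm, dist_eq_norm]
    simpa using sub_le_iff_le_add.1 ((sub_eq_add_neg _ _).trans_le h)
  · have h2 := le_of_abs_le (abs_dot_le i.1 (w - z))
    have h3 : 2 * ‖i.1‖ * ‖w - z‖ ≤ 2 * 1 * ‖w - z‖ :=
      mul_le_mul_of_nonneg_right (by linarith [hA.norm_le i hi]) (norm_nonneg _)
    linarith

lemma concaveOn (hA : IsHalfPlaneFamily Ω A) (hΩ : Ω.Nonempty) :
    ConcaveOn ℝ univ (lowerEnvelope A) := by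
  refine ⟨convex_univ, fun z _ w _ a b ha hb hab => hA.le_lowerEnvelope fun i hi => ?_⟩
  have h1 := mul_le_mul_of_nonneg_left (hA.lowerEnvelope_le hΩ hi z) ha
  have h2 := mul_le_mul_of_nonneg_left (hA.lowerEnvelope_le hΩ hi w) hb
  rw [dot_add, dot_smul, dot_smul]
  simp only [smul_eq_mul]
  have h3 : i.2 = a * i.2 + b * i.2 := by rw [← add_mul, hab, one_mul]
  linarith

end IsHalfPlaneFamily

/-! ### Splitting the half-planes around `Ω` into left and rest. -/

/-- The half-planes containing `Ω` whose outward normals are within slope `κ` of pointing left,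
normalized by horizontal component `-1`. -/
def leftFamily (κ : ℝ) (Ω : Set (ℝ × ℝ)) : Set ((ℝ × ℝ) × ℝ) :=
  {i | i.1.1 = -1 ∧ |i.1.2| ≤ κ ∧ Ω ⊆ halfPlane i.1 i.2}

/-- The half-planes containing `Ω` with the remaining outward normals, of norm one. -/
def restFamily (κ : ℝ) (Ω : Set (ℝ × ℝ)) : Set ((ℝ × ℝ) × ℝ) :=
  {i | ‖i.1‖ = 1 ∧ κ * -i.1.1 ≤ |i.1.2| ∧ Ω ⊆ halfPlane i.1 i.2}

section

variable {Ω : Set (ℝ × ℝ)} {κ : ℝ}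

lemma exists_subset_halfPlane (hcomp : IsCompact Ω) (n : ℝ × ℝ) : ∃ c, Ω ⊆ halfPlane n c := by
  obtain ⟨c, hc⟩ := (hcomp.image (continuous_dot n)).bddAbove
  exact ⟨c, fun z hz => hc ⟨z, hz, rfl⟩⟩

lemma isHalfPlaneFamily_left (hcomp : IsCompact Ω) (hκ : 0 ≤ κ) (hκ1 : κ ≤ 1) :
    IsHalfPlaneFamily Ω (leftFamily κ Ω) := by
  refine ⟨?_, fun i hi => hi.2.2, fun i hi => ?_⟩
  · obtain ⟨c, hc⟩ := exists_subset_halfPlane hcomp (-1, 0)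
    exact ⟨((-1, 0), c), rfl, by simpa using hκ, hc⟩
  · rw [Prod.norm_def]
    refine max_le ?_ (hi.2.1.trans hκ1)
    rw [hi.1]; simp

lemma isHalfPlaneFamily_rest (hcomp : IsCompact Ω) (hκ : 0 ≤ κ) :
    IsHalfPlaneFamily Ω (restFamily κ Ω) := by
  refine ⟨?_, fun i hi => hi.2.2, fun i hi => hi.1.le⟩
  obtain ⟨c, hc⟩ := exists_subset_halfPlane hcomp (1, 0)
  exact ⟨((1, 0), c), by simp, by simpa using hκ, hc⟩

/-- Every half-plane containing `Ω` is a rescaling of one of the two families. -/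
lemma exists_pos_smul_mem_family {n : ℝ × ℝ} {c : ℝ} (hκ : 0 < κ) (hn : n ≠ 0)
    (hΩ : Ω ⊆ halfPlane n c) :
    ∃ t : ℝ, 0 < t ∧ ((t • n, t * c) ∈ leftFamily κ Ω ∨ (t • n, t * c) ∈ restFamily κ Ω) := by
  have hscale : ∀ t : ℝ, 0 < t → Ω ⊆ halfPlane (t • n) (t * c) := fun t ht z hz => by
    show dot (t • n) z ≤ t * c
    rw [smul_dot]
    exact mul_le_mul_of_nonneg_left (hΩ hz) ht.le
  by_cases h : κ * -n.1 ≤ |n.2|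
  · have hpos : 0 < ‖n‖⁻¹ := inv_pos.2 (norm_pos_iff.2 hn)
    refine ⟨‖n‖⁻¹, hpos, Or.inr ⟨?_, ?_, hscale _ hpos⟩⟩
    · simp only [norm_smul, norm_inv, norm_norm]
      exact inv_mul_cancel₀ (norm_ne_zero_iff.2 hn)
    · have := mul_le_mul_of_nonneg_left h hpos.le
      simp only [Prod.smul_fst, Prod.smul_snd, smul_eq_mul, abs_mul, abs_of_pos hpos]
      linarith
  · rw [not_le] at h
    have hn1 : 0 < -n.1 := pos_of_mul_pos_right ((abs_nonneg _).trans_lt h) hκ.le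
    have hpos : 0 < (-n.1)⁻¹ := inv_pos.2 hn1
    refine ⟨(-n.1)⁻¹, hpos, Or.inl ⟨?_, ?_, hscale _ hpos⟩⟩
    · simp only [Prod.smul_fst, smul_eq_mul]
      have : n.1 ≠ 0 := by linarith
      field_simp
    · simp only [Prod.smul_snd, smul_eq_mul, abs_mul, abs_of_pos hpos]
      rw [inv_mul_le_iff₀ hn1]
      linarith

/-- A half-plane separating `z` from `Ω`, rescaled, belongs to one of the families and makes that
envelope negative. -/
lemma mem_of_lowerEnvelope_nonneg (hconv : Convex ℝ Ω) (hcomp : IsCompact Ω) (hne : Ω.Nonempty)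
    (hκ : 0 < κ) (hκ1 : κ ≤ 1) {z : ℝ × ℝ} (hl : 0 ≤ lowerEnvelope (leftFamily κ Ω) z)
    (hr : 0 ≤ lowerEnvelope (restFamily κ Ω) z) : z ∈ Ω := by
  by_contra hz
  obtain ⟨n, c, hn, hΩ, hc⟩ := exists_separating_normal hconv hcomp.isClosed hne hz
  obtain ⟨t, ht, h⟩ := exists_pos_smul_mem_family hκ hn hΩ
  have h1 : t * c - dot (t • n) z < 0 := by
    rw [smul_dot]; nlinarith
  rcases h with h | h
  · exact absurd ((isHalfPlaneFamily_left hcomp hκ.le hκ1).lowerEnvelope_le hne h z)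
      (not_le.2 (h1.trans_le hl))
  · exact absurd ((isHalfPlaneFamily_rest hcomp hκ.le).lowerEnvelope_le hne h z)
      (not_le.2 (h1.trans_le hr))

/-- This gives the test functions their zero boundary values: a supporting half-plane at a boundary
point, rescaled, lies in one of the families. -/
lemma lowerEnvelope_nonpos_of_notMem_interior (hconv : Convex ℝ Ω) (hcomp : IsCompact Ω)
    (hint : (interior Ω).Nonempty) (hκ : 0 < κ) (hκ1 : κ ≤ 1) {z : ℝ × ℝ}
    (hz : z ∉ interior Ω) :
    lowerEnvelope (leftFamily κ Ω) z ≤ 0 ∨ lowerEnvelope (restFamily κ Ω) z ≤ 0 := by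
  have hne := hint.mono interior_subset
  obtain ⟨n, hn, hΩ⟩ := exists_supporting_normal hconv hint hz
  obtain ⟨t, ht, h⟩ := exists_pos_smul_mem_family hκ hn hΩ
  have h1 : t * dot n z - dot (t • n) z = 0 := by rw [smul_dot, sub_self]
  rcases h with h | h
  · exact Or.inl (((isHalfPlaneFamily_left hcomp hκ.le hκ1).lowerEnvelope_le hne h z).trans h1.le)
  · exact Or.inr (((isHalfPlaneFamily_rest hcomp hκ.le).lowerEnvelope_le hne h z).trans h1.le)

/-- A step of length `ρ` along any unit normal stays in `Ω` and costs at least `ρ` of slack, since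
`n · n ≥ 1`. The gap `ρ` is uniform and survives the infimum. -/
lemma lowerEnvelope_rest_pos (hcomp : IsCompact Ω) (hκ : 0 ≤ κ) {z : ℝ × ℝ}
    (hz : z ∈ interior Ω) : 0 < lowerEnvelope (restFamily κ Ω) z := by
  obtain ⟨ρ, hρ, hball⟩ := Metric.nhds_basis_closedBall.mem_iff.1 (mem_interior_iff_mem_nhds.1 hz)
  refine hρ.trans_le ((isHalfPlaneFamily_rest hcomp hκ).le_lowerEnvelope fun i hi => ?_)
  have h1 : z + ρ • i.1 ∈ Ω := hball (by
    rw [Metric.mem_closedBall, dist_eq_norm, add_sub_cancel_left, norm_smul, hi.1, mul_one,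
      Real.norm_of_nonneg hρ.le])
  have h2 : dot i.1 (z + ρ • i.1) ≤ i.2 := hi.2.2 h1
  have h3 : 1 ≤ dot i.1 i.1 := by
    have h4 : |i.1.1| = 1 ∨ |i.1.2| = 1 := by
      have := hi.1
      rw [Prod.norm_def] at this
      rcases max_choice ‖i.1.1‖ ‖i.1.2‖ with h | h
      · left; rw [h] at this; exact this
      · right; rw [h] at this; exact this
    have e1 := abs_mul_abs_self i.1.1
    have e2 := abs_mul_abs_self i.1.2
    have e3 := mul_self_nonneg i.1.1
    have e4 := mul_self_nonneg i.1.2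
    simp only [dot]
    rcases h4 with h | h
    · rw [h] at e1; linarith
    · rw [h] at e2; linarith
  rw [dot_add, dot_smul] at h2
  nlinarith

/-- The left envelope grows with unit speed in the horizontal direction. -/
lemma lowerEnvelope_left_add (hcomp : IsCompact Ω) (hne : Ω.Nonempty) (hκ : 0 ≤ κ) (hκ1 : κ ≤ 1)
    (z : ℝ × ℝ) (t : ℝ) : lowerEnvelope (leftFamily κ Ω) (z + t • ((1, 0) : ℝ × ℝ))
      = lowerEnvelope (leftFamily κ Ω) z + t := by
  have hA := isHalfPlaneFamily_left hcomp hκ hκ1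
  have key : ∀ (z : ℝ × ℝ) (t : ℝ), lowerEnvelope (leftFamily κ Ω) z + t
      ≤ lowerEnvelope (leftFamily κ Ω) (z + t • ((1, 0) : ℝ × ℝ)) := by
    intro z t
    refine hA.le_lowerEnvelope fun i hi => ?_
    have h1 := hA.lowerEnvelope_le hne hi z
    rw [dot_add, dot_smul]
    simp only [dot, hi.1] at h1 ⊢
    linarith
  refine le_antisymm ?_ (key z t)
  have h := key (z + t • ((1, 0) : ℝ × ℝ)) (-t)
  rw [neg_smul, add_neg_cancel_right] at h
  linarith

/-- The cone with slopes `±κ⁻¹` circumscribed about `Ω` on the left: its vertex satisfies all the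
constraints of the rest family. -/
lemma exists_left_vertex (hcomp : IsCompact Ω) (hne : Ω.Nonempty) (hκ : 0 < κ) :
    ∃ C : ℝ × ℝ, (∀ z ∈ Ω, |z.2 - C.2| ≤ κ⁻¹ * (z.1 - C.1)) ∧
      0 ≤ lowerEnvelope (restFamily κ Ω) C := by
  obtain ⟨P, hP, hPmax⟩ := hcomp.exists_isMaxOn hne (continuous_dot (-1, κ)).continuousOn
  obtain ⟨Q, hQ, hQmax⟩ := hcomp.exists_isMaxOn hne (continuous_dot (-1, -κ)).continuousOn
  rw [isMaxOn_iff] at hPmax hQmax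
  -- `C` is the intersection of the support lines with normals `(-1, κ)` at `P` and `(-1, -κ)` at
  -- `Q`.
  obtain ⟨C, hC⟩ : ∃ C : ℝ × ℝ, C = (-(dot (-1, κ) P + dot (-1, -κ) Q) / 2,
    (dot (-1, κ) P - dot (-1, -κ) Q) / (2 * κ)) := ⟨_, rfl⟩
  have hCP : dot (-1, κ) C = dot (-1, κ) P := by
    rw [hC]; simp only [dot]; field_simp; ring
  have hCQ : dot (-1, -κ) C = dot (-1, -κ) Q := by
    rw [hC]; simp only [dot]; field_simp; ring
  refine ⟨C, fun z hz => ?_, (isHalfPlaneFamily_rest hcomp hκ.le).le_lowerEnvelope fun i hi => ?_⟩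
  · have h1 := hPmax z hz
    have h2 := hQmax z hz
    rw [← hCP] at h1
    rw [← hCQ] at h2
    simp only [dot] at h1 h2
    rw [inv_mul_eq_div, le_div_iff₀ hκ, ← abs_of_pos hκ, ← abs_mul, abs_le]
    constructor <;> linarith
  · obtain ⟨-, hrest, hsub⟩ := hi
    -- A half-plane containing `P` and `Q` but not `C` has a normal pairing positively with both `C
    -- - P` and `C - Q`. These run along the two edges of the cone, which forces `|n₂| < κ * -n₁`, a
    -- left normal.
    by_contra hcon
    have hiP : dot i.1 P ≤ i.2 := hsub hP
    have hiQ : dot i.1 Q ≤ i.2 := hsub hQ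
    have hPQ := hPmax Q hQ
    have hQP := hQmax P hP
    rw [← hCP] at hPQ
    rw [← hCQ] at hQP
    simp only [dot] at hCP hCQ hiP hiQ hPQ hQP hcon
    obtain ⟨⟨n₁, n₂⟩, c⟩ := i
    simp only at hrest hiP hiQ hcon
    have e1 : C.1 - P.1 = κ * (C.2 - P.2) := by linarith
    have e2 : C.1 - Q.1 = -(κ * (C.2 - Q.2)) := by linarith
    have s1 : C.2 - P.2 ≤ 0 := by nlinarith
    have s2 : 0 ≤ C.2 - Q.2 := by nlinarith
    have f1 : 0 < (κ * n₁ + n₂) * (C.2 - P.2) := by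
      have : (κ * n₁ + n₂) * (C.2 - P.2) = n₁ * (C.1 - P.1) + n₂ * (C.2 - P.2) := by
        rw [e1]; ring
      rw [this]; linarith
    have f2 : 0 < (-(κ * n₁) + n₂) * (C.2 - Q.2) := by
      have : (-(κ * n₁) + n₂) * (C.2 - Q.2) = n₁ * (C.1 - Q.1) + n₂ * (C.2 - Q.2) := by
        rw [e2]; ring
      rw [this]; linarith
    have g1 : κ * n₁ + n₂ < 0 := by
      by_contra hh
      exact absurd f1 (not_lt.2 (mul_nonpos_of_nonneg_of_nonpos (not_lt.1 hh) s1))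
    have g2 : 0 < -(κ * n₁) + n₂ := pos_of_mul_pos_left f2 s2
    have : |n₂| < κ * -n₁ := by rw [abs_lt]; constructor <;> linarith
    linarith

/-- A point outside `Ω` at which the rest envelope is nonnegative gives a boundary point at which
it is positive. -/
lemma exists_frontier_pos (hcomp : IsCompact Ω)
    (hint : (interior Ω).Nonempty) (hκ : 0 ≤ κ) {C : ℝ × ℝ} (hC : C ∉ Ω)
    (hC0 : 0 ≤ lowerEnvelope (restFamily κ Ω) C) :
    ∃ q ∈ frontier Ω, 0 < lowerEnvelope (restFamily κ Ω) q := by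
  obtain ⟨P, hP⟩ := hint
  have hne : Ω.Nonempty := ⟨P, interior_subset hP⟩
  have hseg : IsPreconnected (segment ℝ P C) := (convex_segment P C).isPreconnected
  obtain ⟨q, hqs, hq⟩ : (segment ℝ P C ∩ frontier Ω).Nonempty := by
    by_contra hcon
    rw [not_nonempty_iff_eq_empty] at hcon
    have h := hseg (interior Ω) Ωᶜ isOpen_interior hcomp.isClosed.isOpen_compl (fun z hz => by
        by_cases hzi : z ∈ interior Ω
        · exact Or.inl hzi
        · refine Or.inr fun hzΩ => ?_
          have : z ∈ segment ℝ P C ∩ frontier Ω := ⟨hz, subset_closure hzΩ, hzi⟩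
          rw [hcon] at this
          exact this)
      ⟨P, left_mem_segment ℝ P C, hP⟩ ⟨C, right_mem_segment ℝ P C, hC⟩
    obtain ⟨z, -, hz1, hz2⟩ := h
    exact hz2 (interior_subset hz1)
  refine ⟨q, hq, ?_⟩
  obtain ⟨a, b, ha, hb, hab, rfl⟩ := hqs
  have hpos := lowerEnvelope_rest_pos hcomp hκ hP
  have ha0 : 0 < a := by
    refine lt_of_le_of_ne ha ?_
    rintro rfl
    have hb1 : b = 1 := by linarith
    rw [hb1, zero_smul, zero_add, one_smul] at hq
    exact hC (hcomp.isClosed.frontier_subset hq)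
  -- By concavity the value at `q` is at least `a` times a positive value plus `b` times a
  -- nonnegative one, with `a > 0`.
  have h := ((isHalfPlaneFamily_rest hcomp hκ).concaveOn hne).2 (mem_univ P) (mem_univ C) ha hb hab
  simp only [smul_eq_mul] at h
  exact lt_of_lt_of_le (by positivity) h

end

/-! ### Necessity at the left end: steep test functions. -/

/-- The lower envelope of the rest family and of the left family stretched by the factor `L`. -/
noncomputable def steepFunction (κ : ℝ) (Ω : Set (ℝ × ℝ)) (L : ℝ) (z : ℝ × ℝ) : ℝ :=
  min (lowerEnvelope (restFamily κ Ω) z) (L * lowerEnvelope (leftFamily κ Ω) z)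

/-- The part of the interior where the stretched left envelope is active. -/
def steepRegion (κ : ℝ) (Ω : Set (ℝ × ℝ)) (L : ℝ) : Set (ℝ × ℝ) :=
  interior Ω ∩ {z | L * lowerEnvelope (leftFamily κ Ω) z < lowerEnvelope (restFamily κ Ω) z}

section

variable {Ω : Set (ℝ × ℝ)} {κ L : ℝ}

lemma lowerEnvelope_left_pos (hcomp : IsCompact Ω) (hκ : 0 ≤ κ) (hκ1 : κ ≤ 1) {z : ℝ × ℝ}
    (hz : z ∈ interior Ω) : 0 < lowerEnvelope (leftFamily κ Ω) z := by
  have hne : Ω.Nonempty := ⟨z, interior_subset hz⟩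
  obtain ⟨ρ, hρ, hball⟩ := Metric.nhds_basis_closedBall.mem_iff.1 (mem_interior_iff_mem_nhds.1 hz)
  have h1 : z + (-ρ) • ((1, 0) : ℝ × ℝ) ∈ Ω := hball (by
    rw [Metric.mem_closedBall, dist_eq_norm, add_sub_cancel_left, norm_smul]
    simp [Prod.norm_def, abs_of_pos hρ])
  have h2 := (isHalfPlaneFamily_left hcomp hκ hκ1).lowerEnvelope_nonneg h1
  rw [lowerEnvelope_left_add hcomp hne hκ hκ1] at h2
  linarith

lemma lipschitzWith_steepFunction (hcomp : IsCompact Ω) (hne : Ω.Nonempty) (hκ : 0 ≤ κ)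
    (hκ1 : κ ≤ 1) : ∃ C, LipschitzWith C (steepFunction κ Ω L) := by
  have h1 := (isHalfPlaneFamily_rest hcomp hκ).lipschitzWith hne
  have h2 := (lipschitzWith_smul L).comp ((isHalfPlaneFamily_left hcomp hκ hκ1).lipschitzWith hne)
  exact ⟨_, h1.min h2⟩

lemma isAdmissible_steepFunction (hconv : Convex ℝ Ω) (hcomp : IsCompact Ω)
    (hint : (interior Ω).Nonempty) (hκ : 0 < κ) (hκ1 : κ ≤ 1) (hL : 0 ≤ L) :
    IsAdmissible Ω (steepFunction κ Ω L) := by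
  have hne := hint.mono interior_subset
  have hl := isHalfPlaneFamily_left hcomp hκ.le hκ1
  have hr := isHalfPlaneFamily_rest hcomp hκ.le
  obtain ⟨C, hC⟩ := lipschitzWith_steepFunction (L := L) hcomp hne hκ.le hκ1
  refine ⟨hC.continuous.continuousOn, ?_, fun z hz => ?_, C, fun z _ _ => ⟨?_, ?_⟩⟩
  · exact (((hr.concaveOn hne).inf ((hl.concaveOn hne).smul hL))).subset (subset_univ _) hconv
  · have hzΩ := hcomp.isClosed.frontier_subset hz
    have h1 := hl.lowerEnvelope_nonneg hzΩ
    have h2 := hr.lowerEnvelope_nonneg hzΩ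
    refine le_antisymm ?_ (le_min h2 (mul_nonneg hL h1))
    rcases lowerEnvelope_nonpos_of_notMem_interior hconv hcomp hint hκ hκ1 hz.2 with h | h
    · exact (min_le_right _ _).trans (mul_nonpos_of_nonneg_of_nonpos hL h)
    · exact (min_le_left _ _).trans h
  all_goals
    refine ((ContinuousLinearMap.le_opNorm _ _).trans
      (mul_le_mul_of_nonneg_right (norm_fderiv_le_of_lipschitz ℝ hC) (norm_nonneg _))).trans ?_
    simp [Prod.norm_def]

/-- On the steep region the derivatives of the steep function are those of the left envelope,
stretched. -/
lemma mul_le_fderiv_steepFunction (hcomp : IsCompact Ω) (hne : Ω.Nonempty) (hκ : 0 ≤ κ)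
    (hκ1 : κ ≤ 1) (hL : 0 ≤ L) {z e : ℝ × ℝ} {k : ℝ} (hz : z ∈ steepRegion κ Ω L)
    (hd : DifferentiableAt ℝ (steepFunction κ Ω L) z) (h : ∀ i ∈ leftFamily κ Ω, k ≤ -dot i.1 e) :
    L * k ≤ fderiv ℝ (steepFunction κ Ω L) z e := by
  have hl := isHalfPlaneFamily_left hcomp hκ hκ1
  have hcl := (hl.lipschitzWith hne).continuous
  have hcr := ((isHalfPlaneFamily_rest hcomp hκ).lipschitzWith hne).continuous
  refine le_fderiv_of_eventually hd ?_
  have hopen : IsOpen {z | L * lowerEnvelope (leftFamily κ Ω) z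
      < lowerEnvelope (restFamily κ Ω) z} := isOpen_lt (hcl.const_mul L) hcr
  have hline : Tendsto (fun t : ℝ => z + t • e) (𝓝[>] 0) (𝓝 z) := by
    have : Continuous fun t : ℝ => z + t • e := by fun_prop
    have h0 := this.tendsto 0
    rw [zero_smul, add_zero] at h0
    exact h0.mono_left nhdsWithin_le_nhds
  filter_upwards [hline.eventually (hopen.mem_nhds hz.2), self_mem_nhdsWithin] with t ht ht0
  have h1 := mul_le_mul_of_nonneg_left (hl.lowerEnvelope_add_le hne h z (le_of_lt ht0)) hL
  have h2 : L * lowerEnvelope (leftFamily κ Ω) z ≤ lowerEnvelope (restFamily κ Ω) z := le_of_lt hz.2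
  have h3 : L * lowerEnvelope (leftFamily κ Ω) (z + t • e)
      ≤ lowerEnvelope (restFamily κ Ω) (z + t • e) := le_of_lt ht
  simp only [steepFunction]
  rw [min_eq_right h2, min_eq_right h3]
  linarith

lemma le_partialX_steepFunction (hcomp : IsCompact Ω) (hne : Ω.Nonempty) (hκ : 0 ≤ κ)
    (hκ1 : κ ≤ 1) (hL : 0 ≤ L) {z : ℝ × ℝ} (hz : z ∈ steepRegion κ Ω L)
    (hd : DifferentiableAt ℝ (steepFunction κ Ω L) z) :
    L ≤ partialX (steepFunction κ Ω L) z := by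
  have h := mul_le_fderiv_steepFunction hcomp hne hκ hκ1 hL (e := (1, 0)) (k := 1) hz hd
    fun i hi => by simp [dot, hi.1]
  rwa [mul_one] at h

lemma abs_partialY_steepFunction_le (hcomp : IsCompact Ω) (hne : Ω.Nonempty) (hκ : 0 ≤ κ)
    (hκ1 : κ ≤ 1) (hL : 0 ≤ L) {z : ℝ × ℝ} (hz : z ∈ steepRegion κ Ω L)
    (hd : DifferentiableAt ℝ (steepFunction κ Ω L) z) :
    |partialY (steepFunction κ Ω L) z| ≤ L * κ := by
  have h1 := mul_le_fderiv_steepFunction hcomp hne hκ hκ1 hL (e := (0, 1)) (k := -κ) hz hd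
    fun i hi => by simpa [dot] using (abs_le.1 hi.2.1).2
  have h2 := mul_le_fderiv_steepFunction hcomp hne hκ hκ1 hL (e := (0, -1)) (k := -κ) hz hd
    fun i hi => by simpa [dot] using (abs_le.1 hi.2.1).1
  rw [fderiv_eq_partial] at h1 h2
  simp only [mul_zero, mul_one, zero_add, mul_neg] at h1 h2
  rw [abs_le]
  constructor <;> linarith

/-- A bound independent of `L`. The complement of the steep region need not be open, so nearby the
function is only known to lie below the rest envelope, which it touches at `z`. This one-sided
comparison in both vertical directions suffices, the rest envelope being 2-Lipschitz. -/
lemma abs_partialY_steepFunction_le_two (hcomp : IsCompact Ω) (hne : Ω.Nonempty) (hκ : 0 ≤ κ)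
    {z : ℝ × ℝ} (hz : z ∈ interior Ω) (hz' : z ∉ steepRegion κ Ω L)
    (hd : DifferentiableAt ℝ (steepFunction κ Ω L) z) :
    |partialY (steepFunction κ Ω L) z| ≤ 2 := by
  have hv : lowerEnvelope (restFamily κ Ω) z ≤ L * lowerEnvelope (leftFamily κ Ω) z := by
    by_contra h
    exact hz' ⟨hz, not_le.1 h⟩
  have hr := isHalfPlaneFamily_rest hcomp hκ
  have key : ∀ e : ℝ × ℝ, ‖e‖ ≤ 1 → fderiv ℝ (steepFunction κ Ω L) z e ≤ 2 := by
    intro e he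
    have h := le_fderiv_of_eventually (k := -2) (e := e) hd.neg ?_
    · rw [fderiv_neg] at h
      simpa using h
    · filter_upwards [self_mem_nhdsWithin] with t ht
      have ht0 : 0 < t := ht
      have h1 : steepFunction κ Ω L z = lowerEnvelope (restFamily κ Ω) z := min_eq_left hv
      have h2 : steepFunction κ Ω L (z + t • e) ≤ lowerEnvelope (restFamily κ Ω) (z + t • e) :=
        min_le_left _ _
      have h3 := (hr.lipschitzWith hne).dist_le_mul (z + t • e) z
      rw [dist_eq_norm (z + t • e), add_sub_cancel_left, norm_smul, Real.norm_of_nonneg ht0.le,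
        Real.dist_eq] at h3
      have h4 := le_of_abs_le h3
      have h5 := mul_le_mul_of_nonneg_left he ht0.le
      simp only [NNReal.coe_ofNat] at h4
      simp only [Pi.neg_apply]
      linarith
  have h1 := key (0, 1) (by simp [Prod.norm_def])
  have h2 := key (0, -1) (by simp [Prod.norm_def])
  rw [fderiv_eq_partial] at h1 h2
  simp only [mul_zero, mul_one, zero_add, mul_neg] at h1 h2
  rw [abs_le]
  constructor <;> linarith

lemma isOpen_steepRegion (hcomp : IsCompact Ω) (hne : Ω.Nonempty) (hκ : 0 ≤ κ) (hκ1 : κ ≤ 1) :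
    IsOpen (steepRegion κ Ω L) :=
  isOpen_interior.inter (isOpen_lt
    (((isHalfPlaneFamily_left hcomp hκ hκ1).lipschitzWith hne).continuous.const_mul L)
    ((isHalfPlaneFamily_rest hcomp hκ).lipschitzWith hne).continuous)

lemma le_eLpNorm_partialX_steepFunction (hcomp : IsCompact Ω)
    (hne : Ω.Nonempty) (hκ : 0 ≤ κ) (hκ1 : κ ≤ 1) (hL : 0 ≤ L) {p : ℝ≥0∞} (hp : p ≠ 0)
    (hpt : p ≠ ∞) :
    ENNReal.ofReal L * volume (steepRegion κ Ω L) ^ (1 / p.toReal)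
      ≤ eLpNorm (partialX (steepFunction κ Ω L)) p (volume.restrict Ω) := by
  have hE := (isOpen_steepRegion (L := L) hcomp hne hκ hκ1).measurableSet
  obtain ⟨C, hC⟩ := lipschitzWith_steepFunction (L := L) hcomp hne hκ hκ1
  have hEΩ : steepRegion κ Ω L ⊆ Ω := inter_subset_left.trans interior_subset
  have h := eLpNorm_indicator_const (μ := volume.restrict Ω) (c := L) hE hp hpt
  rw [Measure.restrict_apply hE, inter_eq_left.2 hEΩ, Real.enorm_eq_ofReal hL] at h
  rw [← h]
  refine eLpNorm_mono_ae ?_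
  filter_upwards [ae_restrict_of_ae hC.ae_differentiableAt] with z hz
  by_cases hzE : z ∈ steepRegion κ Ω L
  · rw [indicator_of_mem hzE, Real.norm_of_nonneg hL]
    exact (le_partialX_steepFunction hcomp hne hκ hκ1 hL hzE hz).trans (le_abs_self _)
  · rw [indicator_of_notMem hzE]
    simp

lemma eLpNorm_partialY_steepFunction_le (hconv : Convex ℝ Ω) (hcomp : IsCompact Ω)
    (hne : Ω.Nonempty) (hκ : 0 ≤ κ) (hκ1 : κ ≤ 1) (hL : 0 ≤ L) {p : ℝ≥0∞} (hp : 1 ≤ p)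
    (hpt : p ≠ ∞) :
    eLpNorm (partialY (steepFunction κ Ω L)) p (volume.restrict Ω)
      ≤ ENNReal.ofReal (L * κ) * volume (steepRegion κ Ω L) ^ (1 / p.toReal)
        + 2 * volume Ω ^ (1 / p.toReal) := by
  have hp0 : p ≠ 0 := (zero_lt_one.trans_le hp).ne'
  have hE := (isOpen_steepRegion (L := L) hcomp hne hκ hκ1).measurableSet
  obtain ⟨C, hC⟩ := lipschitzWith_steepFunction (L := L) hcomp hne hκ hκ1
  have hEΩ : steepRegion κ Ω L ⊆ Ω := inter_subset_left.trans interior_subset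
  have hLκ := mul_nonneg hL hκ
  have h := eLpNorm_indicator_const (μ := volume.restrict Ω) (c := L * κ) hE hp0 hpt
  rw [Measure.restrict_apply hE, inter_eq_left.2 hEΩ, Real.enorm_eq_ofReal hLκ] at h
  have h2 := eLpNorm_const' (μ := volume.restrict Ω) (2 : ℝ) hp0 hpt
  rw [Measure.restrict_apply_univ, Real.enorm_eq_ofReal zero_le_two,
    ENNReal.ofReal_ofNat] at h2
  rw [← h, ← h2]
  refine le_trans ?_ (eLpNorm_add_le ((aestronglyMeasurable_const).indicator hE)
    aestronglyMeasurable_const hp)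
  refine eLpNorm_mono_ae ?_
  have hres : volume.restrict Ω = volume.restrict (interior Ω) :=
    Measure.restrict_congr_set
      (interior_ae_eq_of_null_frontier (hconv.addHaar_frontier volume)).symm
  rw [hres]
  filter_upwards [ae_restrict_of_ae hC.ae_differentiableAt,
    ae_restrict_mem isOpen_interior.measurableSet] with z hz hzi
  rw [Pi.add_apply]
  refine le_trans ?_ (le_abs_self _)
  by_cases hzE : z ∈ steepRegion κ Ω L
  · rw [indicator_of_mem hzE]
    have := abs_partialY_steepFunction_le hcomp hne hκ hκ1 hL hzE hz
    exact this.trans (by linarith)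
  · rw [indicator_of_notMem hzE, zero_add]
    exact abs_partialY_steepFunction_le_two hcomp hne hκ hzi hzE hz

/-- The steep region has area of order `1 / L` at least. -/
lemma exists_le_volume_steepRegion (hconv : Convex ℝ Ω) (hcomp : IsCompact Ω)
    (hint : (interior Ω).Nonempty) (hκ : 0 < κ) (hκ1 : κ ≤ 1) {q : ℝ × ℝ} (hq : q ∈ frontier Ω)
    (hqpos : 0 < lowerEnvelope (restFamily κ Ω) q) :
    ∃ c : ℝ, 0 < c ∧ ∃ L₀ : ℝ, 0 < L₀ ∧ ∀ L ≥ L₀,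
      ENNReal.ofReal (c / L) ≤ volume (steepRegion κ Ω L) := by
  have hne := hint.mono interior_subset
  have hl := isHalfPlaneFamily_left hcomp hκ.le hκ1
  have hr := isHalfPlaneFamily_rest hcomp hκ.le
  have hcl := (hl.lipschitzWith hne).continuous
  have hcr := (hr.lipschitzWith hne).continuous
  have hq0 : lowerEnvelope (leftFamily κ Ω) q = 0 := by
    refine le_antisymm ?_ (hl.lowerEnvelope_nonneg (hcomp.isClosed.frontier_subset hq))
    exact (lowerEnvelope_nonpos_of_notMem_interior hconv hcomp hint hκ hκ1 hq.2).resolve_right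
      (not_le.2 hqpos)
  -- By its unit horizontal speed the left envelope is `x - F y`, so its zero set is the graph of
  -- `F`, which passes through `q`.
  obtain ⟨F, hF⟩ : ∃ F : ℝ → ℝ, F = fun y => -lowerEnvelope (leftFamily κ Ω) (0, y) := ⟨_, rfl⟩
  have hFc : Continuous F := by rw [hF]; fun_prop
  have hleft : ∀ x y, lowerEnvelope (leftFamily κ Ω) (x, y) = x - F y := by
    intro x y
    have h := lowerEnvelope_left_add hcomp hne hκ.le hκ1 (0, y) x
    have e : ((0, y) : ℝ × ℝ) + x • ((1, 0) : ℝ × ℝ) = (x, y) := by simp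
    rw [e] at h
    rw [h, hF]; ring
  have hFq : F q.2 = q.1 := by
    have := hleft q.1 q.2
    rw [Prod.mk.eta, hq0] at this
    linarith
  set δ := lowerEnvelope (restFamily κ Ω) q / 2 with hδ
  have hδ0 : 0 < δ := by positivity
  have hlt : δ < lowerEnvelope (restFamily κ Ω) q := by linarith
  obtain ⟨r, hr0, hrball⟩ := Metric.mem_nhds_iff.1 (hcr.continuousAt.eventually_const_lt hlt)
  obtain ⟨r', hr'0, hr'⟩ := Metric.continuousAt_iff.1 hFc.continuousAt (r / 2) (half_pos hr0)
  set s := min r r' with hs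
  have hs0 : 0 < s := lt_min hr0 hr'0
  -- The strip of width `δ / L` to the right of the graph and of height `2 s` lies in the steep
  -- region. The bound `L ≥ 2 δ / r` makes the width at most `r / 2`, keeping the strip in the ball
  -- where the rest envelope exceeds `δ`.
  refine ⟨δ * (2 * s), by positivity, 2 * δ / r, by positivity, fun L hL => ?_⟩
  have hL0 : 0 < L := lt_of_lt_of_le (by positivity) hL
  have hδL : δ / L ≤ r / 2 := by
    rw [div_le_iff₀ hL0]
    have := (div_le_iff₀ hr0).1 hL
    linarith
  have hsub : ∀ y ∈ Ioo (q.2 - s) (q.2 + s), ∀ x ∈ Ioo (F y) (F y + δ / L),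
      (x, y) ∈ steepRegion κ Ω L := by
    intro y hy x hx
    have hys : |y - q.2| < s := abs_lt.2 ⟨by linarith [hy.1], by linarith [hy.2]⟩
    have hFy : |F y - F q.2| < r / 2 := hr' (hys.trans_le (min_le_right _ _))
    rw [hFq] at hFy
    have hxq : |x - q.1| < r := by
      have := abs_lt.1 hFy
      rw [abs_lt]
      constructor
      · linarith [hx.1]
      · linarith [hx.2]
    have hv : δ < lowerEnvelope (restFamily κ Ω) (x, y) :=
      hrball (Prod.mk.eta (p := q) ▸ (by
        rw [Metric.mem_ball, Prod.dist_eq]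
        exact max_lt hxq (hys.trans_le (min_le_left _ _))))
    have hd0 : 0 < lowerEnvelope (leftFamily κ Ω) (x, y) := by rw [hleft]; linarith [hx.1]
    refine ⟨?_, ?_⟩
    · have hopen : IsOpen {z | 0 < lowerEnvelope (leftFamily κ Ω) z ∧
          0 < lowerEnvelope (restFamily κ Ω) z} :=
        (isOpen_lt continuous_const hcl).inter (isOpen_lt continuous_const hcr)
      refine interior_maximal (fun z hz => ?_) hopen ⟨hd0, hδ0.trans hv⟩
      exact mem_of_lowerEnvelope_nonneg hconv hcomp hne hκ hκ1 hz.1.le hz.2.le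
    · refine lt_trans ?_ hv
      rw [hleft]
      have : x - F y < δ / L := by linarith [hx.2]
      calc L * (x - F y) < L * (δ / L) := mul_lt_mul_of_pos_left this hL0
        _ = δ := by field_simp
  have hE := (isOpen_steepRegion (L := L) hcomp hne hκ.le hκ1).measurableSet
  rw [Measure.volume_eq_prod, Measure.prod_apply_symm hE]
  calc ENNReal.ofReal (δ * (2 * s) / L)
      = ∫⁻ _ in Ioo (q.2 - s) (q.2 + s), ENNReal.ofReal (δ / L) := by
        rw [setLIntegral_const, Real.volume_Ioo, ← ENNReal.ofReal_mul (by positivity)]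
        congr 1; ring
    _ ≤ ∫⁻ y in Ioo (q.2 - s) (q.2 + s), volume ((fun x => (x, y)) ⁻¹' steepRegion κ Ω L) := by
        refine setLIntegral_mono' measurableSet_Ioo fun y hy => ?_
        calc ENNReal.ofReal (δ / L) = volume (Ioo (F y) (F y + δ / L)) := by
              rw [Real.volume_Ioo]; congr 1; ring
          _ ≤ _ := measure_mono fun x hx => hsub y hy x hx
    _ ≤ _ := setLIntegral_le_lintegral _ _

/-- A vanishing denominator does no harm: a positive number over zero is `∞`, so finiteness of `K`
makes the numerator vanish too. -/
lemma eLpNorm_partialX_le_K_mul {p : ℝ≥0∞} {u : ℝ × ℝ → ℝ} (hK : K p Ω ≠ ∞)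
    (hu : IsAdmissible Ω u) (hu0 : ∃ z ∈ Ω, u z ≠ 0)
    (hY : eLpNorm (partialY u) p (volume.restrict Ω) ≠ ∞) :
    eLpNorm (partialX u) p (volume.restrict Ω)
      ≤ K p Ω * eLpNorm (partialY u) p (volume.restrict Ω) := by
  have h : eLpNorm (partialX u) p (volume.restrict Ω) / eLpNorm (partialY u) p (volume.restrict Ω)
      ≤ K p Ω := by
    unfold K
    exact le_iSup_of_le u (le_iSup_of_le hu (le_iSup_of_le hu0 le_rfl))
  exact (ENNReal.div_le_iff_le_mul (Or.inr hK) (Or.inl hY)).1 h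

/-- If `K_p(Ω)` is finite, then `Ω` lies in a cone at its left end. -/
lemma exists_left_cone_of_K_lt_top (hconv : Convex ℝ Ω) (hcomp : IsCompact Ω)
    (hint : (interior Ω).Nonempty) {p : ℝ≥0∞} (hp : 1 < p) (hpt : p ≠ ∞) (hK : K p Ω ≠ ∞) :
    ∃ M : ℝ, 0 < M ∧ ∃ C ∈ Ω, ∀ z ∈ Ω, |z.2 - C.2| ≤ M * (z.1 - C.1) := by
  have hne := hint.mono interior_subset
  set k := (K p Ω).toReal with hk
  have hk0 : 0 ≤ k := ENNReal.toReal_nonneg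
  -- Chosen so that `k κ ≤ 1/2`: the steep part of `‖u_y‖`, multiplied by `k`, is absorbed by half
  -- of `‖u_x‖`.
  set κ := 1 / (2 * (k + 1)) with hκdef
  have hκ : 0 < κ := by positivity
  have hκ1 : κ ≤ 1 := by
    rw [hκdef, div_le_one (by positivity)]; linarith
  have hkκ : k * κ ≤ 1 / 2 := by
    rw [hκdef, mul_one_div, div_le_div_iff₀ (by positivity) (by positivity)]; linarith
  obtain ⟨C, hcone, hC0⟩ := exists_left_vertex hcomp hne hκ
  by_cases hC : C ∈ Ω
  · exact ⟨κ⁻¹, inv_pos.2 hκ, C, hC, hcone⟩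
  exfalso
  obtain ⟨q, hq, hqpos⟩ := exists_frontier_pos hcomp hint hκ.le hC hC0
  obtain ⟨c, hc, L₀, hL₀, hvol⟩ := exists_le_volume_steepRegion hconv hcomp hint hκ hκ1 hq hqpos
  have hp1 : 1 < p.toReal := by
    rw [← ENNReal.toReal_one]
    exact (ENNReal.toReal_lt_toReal ENNReal.one_ne_top hpt).2 hp
  have hp0 : 0 < p.toReal := zero_lt_one.trans hp1
  have hinv : 0 ≤ 1 / p.toReal := by positivity
  have hΩfin : volume Ω ≠ ∞ := hcomp.measure_lt_top.ne
  set ω := (volume Ω).toReal ^ (1 / p.toReal) with hω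
  have hbound : ∀ L ≥ L₀, L ^ (1 - 1 / p.toReal) * c ^ (1 / p.toReal) ≤ 4 * k * ω := by
    intro L hL
    have hL0 : 0 < L := hL₀.trans_le hL
    have hEfin : volume (steepRegion κ Ω L) ≠ ∞ :=
      ((measure_mono (inter_subset_left.trans interior_subset)).trans_lt
        hcomp.measure_lt_top).ne
    have hX := le_eLpNorm_partialX_steepFunction hcomp hne hκ.le hκ1 hL0.le
      (zero_lt_one.trans hp).ne' hpt
    have hY := eLpNorm_partialY_steepFunction_le hconv hcomp hne hκ.le hκ1 hL0.le hp.le hpt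
    have hEp : volume (steepRegion κ Ω L) ^ (1 / p.toReal) ≠ ∞ :=
      ENNReal.rpow_ne_top_of_nonneg hinv hEfin
    have hΩp : volume Ω ^ (1 / p.toReal) ≠ ∞ := ENNReal.rpow_ne_top_of_nonneg hinv hΩfin
    have hRfin : ENNReal.ofReal (L * κ) * volume (steepRegion κ Ω L) ^ (1 / p.toReal)
        + 2 * volume Ω ^ (1 / p.toReal) ≠ ∞ :=
      ENNReal.add_ne_top.2 ⟨ENNReal.mul_ne_top ENNReal.ofReal_ne_top hEp,
        ENNReal.mul_ne_top ENNReal.ofNat_ne_top hΩp⟩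
    obtain ⟨P, hP⟩ := hint
    have hnz : ∃ z ∈ Ω, steepFunction κ Ω L z ≠ 0 :=
      ⟨P, interior_subset hP, (lt_min (lowerEnvelope_rest_pos hcomp hκ.le hP)
        (mul_pos hL0 (lowerEnvelope_left_pos hcomp hκ.le hκ1 hP))).ne'⟩
    have hXY := eLpNorm_partialX_le_K_mul hK
      (isAdmissible_steepFunction hconv hcomp ⟨P, hP⟩ hκ hκ1 hL0.le) hnz (ne_top_of_le_ne_top hRfin hY)
    have hall := (hX.trans hXY).trans (mul_le_mul_right hY _)
    have hreal := ENNReal.toReal_mono (ENNReal.mul_ne_top hK hRfin) hall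
    rw [ENNReal.toReal_mul, ENNReal.toReal_mul, ENNReal.toReal_add
      (ENNReal.mul_ne_top ENNReal.ofReal_ne_top hEp) (ENNReal.mul_ne_top ENNReal.ofNat_ne_top hΩp),
      ENNReal.toReal_mul, ENNReal.toReal_mul, ENNReal.toReal_ofReal hL0.le,
      ENNReal.toReal_ofReal (by positivity), ← ENNReal.toReal_rpow, ← ENNReal.toReal_rpow,
      ← hk, ← hω, ENNReal.toReal_ofNat] at hreal
    set ε := (volume (steepRegion κ Ω L)).toReal ^ (1 / p.toReal) with hε
    have hε0 : 0 ≤ ε := by positivity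
    -- From `L ε ≤ k (L κ ε + 2 ω)`, after absorbing `k κ L ε ≤ L ε / 2`.
    have h1 : L * ε ≤ 4 * k * ω := by
      have : (k * κ) * (L * ε) ≤ 1 / 2 * (L * ε) :=
        mul_le_mul_of_nonneg_right hkκ (mul_nonneg hL0.le hε0)
      linarith
    have h2 : (c / L) ^ (1 / p.toReal) ≤ ε := by
      refine Real.rpow_le_rpow (by positivity) ?_ hinv
      exact (ENNReal.ofReal_le_iff_le_toReal hEfin).1 (hvol L hL)
    calc L ^ (1 - 1 / p.toReal) * c ^ (1 / p.toReal) = L * (c / L) ^ (1 / p.toReal) := by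
          rw [Real.rpow_sub hL0, Real.rpow_one, Real.div_rpow hc.le hL0.le]; ring
      _ ≤ L * ε := mul_le_mul_of_nonneg_left h2 hL0.le
      _ ≤ _ := h1
  -- Strictness of `p > 1` makes the exponent positive, so the left side of `hbound` is unbounded in
  -- `L`.
  have hexp : 0 < 1 - 1 / p.toReal := by
    rw [sub_pos, div_lt_one hp0]; exact hp1
  have htend : Tendsto (fun L : ℝ => L ^ (1 - 1 / p.toReal) * c ^ (1 / p.toReal)) atTop atTop :=
    (tendsto_rpow_atTop hexp).atTop_mul_const (by positivity)
  obtain ⟨L, hL1, hL2⟩ := ((htend.eventually_gt_atTop (4 * k * ω)).and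
    (eventually_ge_atTop L₀)).exists
  exact absurd (hbound L hL2) (not_le.2 hL1)

end

/-! ### The right end by reflection. -/

/-- The reflection of the plane in the vertical axis. -/
noncomputable def reflect : (ℝ × ℝ) ≃L[ℝ] (ℝ × ℝ) :=
  (ContinuousLinearEquiv.neg ℝ).prodCongr (ContinuousLinearEquiv.refl ℝ ℝ)

lemma reflect_apply (z : ℝ × ℝ) : reflect z = (-z.1, z.2) := rfl

lemma reflect_reflect (z : ℝ × ℝ) : reflect (reflect z) = z := by simp [reflect_apply]

lemma measurePreserving_reflect : MeasurePreserving (reflect : ℝ × ℝ → ℝ × ℝ) :=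
  (Measure.measurePreserving_neg (volume : Measure ℝ)).prod (MeasurePreserving.id volume)

lemma partialX_comp_reflect (u : ℝ × ℝ → ℝ) (z : ℝ × ℝ) :
    partialX (u ∘ reflect) z = -partialX u (reflect z) := by
  rw [partialX, reflect.comp_right_fderiv]
  simp only [ContinuousLinearMap.comp_apply, ContinuousLinearEquiv.coe_coe]
  rw [fderiv_eq_partial]
  simp [reflect_apply]

lemma partialY_comp_reflect (u : ℝ × ℝ → ℝ) (z : ℝ × ℝ) :
    partialY (u ∘ reflect) z = partialY u (reflect z) := by
  rw [partialY, reflect.comp_right_fderiv]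
  simp only [ContinuousLinearMap.comp_apply, ContinuousLinearEquiv.coe_coe]
  rw [fderiv_eq_partial]
  simp [reflect_apply]

lemma IsAdmissible.comp_reflect {Ω : Set (ℝ × ℝ)} {u : ℝ × ℝ → ℝ}
    (hu : IsAdmissible (reflect ⁻¹' Ω) u) : IsAdmissible Ω (u ∘ reflect) := by
  have hpre : reflect ⁻¹' (reflect ⁻¹' Ω) = Ω := by
    ext z; simp only [mem_preimage, reflect_reflect]
  have hmaps : MapsTo reflect Ω (reflect ⁻¹' Ω) := fun z hz => by
    rwa [mem_preimage, reflect_reflect]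
  obtain ⟨C, hC⟩ := hu.bounded_gradient
  refine ⟨hu.continuousOn.comp reflect.continuous.continuousOn hmaps, ?_, fun z hz => ?_, C,
    fun z hz hd => ?_⟩
  · have := hu.concaveOn.comp_linearMap (reflect : (ℝ × ℝ) →L[ℝ] (ℝ × ℝ)).toLinearMap
    have h2 : ConcaveOn ℝ (reflect ⁻¹' (reflect ⁻¹' Ω)) (u ∘ reflect) := this
    rwa [hpre] at h2
  · refine hu.eq_zero _ ?_
    have := reflect.toHomeomorph.preimage_frontier (reflect ⁻¹' Ω)
    have h2 : reflect ⁻¹' frontier (reflect ⁻¹' Ω) = frontier (reflect ⁻¹' (reflect ⁻¹' Ω)) := this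
    rw [hpre] at h2
    rw [← h2] at hz
    exact hz
  · have := reflect.toHomeomorph.preimage_interior (reflect ⁻¹' Ω)
    have h2 : reflect ⁻¹' interior (reflect ⁻¹' Ω) = interior (reflect ⁻¹' (reflect ⁻¹' Ω)) := this
    rw [hpre] at h2
    rw [← h2] at hz
    have h := hC (reflect z) hz (reflect.comp_right_differentiableAt_iff.1 hd)
    rwa [partialX_comp_reflect, partialY_comp_reflect, abs_neg]

lemma eLpNorm_comp_reflect {Ω : Set (ℝ × ℝ)} (p : ℝ≥0∞) {f : ℝ × ℝ → ℝ} (hf : Measurable f) :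
    eLpNorm (f ∘ reflect) p (volume.restrict Ω)
      = eLpNorm f p (volume.restrict (reflect ⁻¹' Ω)) := by
  have hpre : reflect ⁻¹' (reflect ⁻¹' Ω) = Ω := by
    ext z; simp only [mem_preimage, reflect_reflect]
  have h := measurePreserving_reflect.restrict_preimage_emb
    reflect.toHomeomorph.measurableEmbedding (reflect ⁻¹' Ω)
  rw [hpre] at h
  exact eLpNorm_comp_measurePreserving hf.aestronglyMeasurable h

lemma K_preimage_reflect_le (p : ℝ≥0∞) (Ω : Set (ℝ × ℝ)) : K p (reflect ⁻¹' Ω) ≤ K p Ω := by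
  refine iSup_le fun u => iSup_le fun hu => iSup_le fun ⟨z, hz, hz0⟩ => ?_
  have hX : eLpNorm (partialX (u ∘ reflect)) p (volume.restrict Ω)
      = eLpNorm (partialX u) p (volume.restrict (reflect ⁻¹' Ω)) := by
    rw [← eLpNorm_comp_reflect p (measurable_partialX u), ← eLpNorm_neg]
    congr 1
    ext z
    simp [partialX_comp_reflect]
  have hY : eLpNorm (partialY (u ∘ reflect)) p (volume.restrict Ω)
      = eLpNorm (partialY u) p (volume.restrict (reflect ⁻¹' Ω)) := by
    rw [← eLpNorm_comp_reflect p (measurable_partialY u)]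
    congr 1
    ext z
    simp [partialY_comp_reflect]
  rw [← hX, ← hY]
  unfold K
  refine le_iSup_of_le (u ∘ reflect) (le_iSup_of_le hu.comp_reflect
    (le_iSup_of_le ⟨reflect z, hz, ?_⟩ le_rfl))
  rwa [Function.comp_apply, reflect_reflect]

/-- If `K_p(Ω)` is finite, then `Ω` lies in a cone at its right end. -/
lemma exists_right_cone_of_K_lt_top {Ω : Set (ℝ × ℝ)} (hconv : Convex ℝ Ω) (hcomp : IsCompact Ω)
    (hint : (interior Ω).Nonempty) {p : ℝ≥0∞} (hp : 1 < p) (hpt : p ≠ ∞) (hK : K p Ω ≠ ∞) :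
    ∃ M : ℝ, 0 < M ∧ ∃ C ∈ Ω, ∀ z ∈ Ω, |z.2 - C.2| ≤ M * (C.1 - z.1) := by
  have hconv' : Convex ℝ (reflect ⁻¹' Ω) :=
    hconv.linear_preimage (reflect : (ℝ × ℝ) →L[ℝ] (ℝ × ℝ)).toLinearMap
  have hcomp' : IsCompact (reflect ⁻¹' Ω) :=
    reflect.toHomeomorph.isCompact_preimage.2 hcomp
  have hint' : (interior (reflect ⁻¹' Ω)).Nonempty := by
    have h2 : reflect ⁻¹' interior Ω = interior (reflect ⁻¹' Ω) :=
      reflect.toHomeomorph.preimage_interior Ω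
    obtain ⟨z, hz⟩ := hint
    rw [← h2]
    exact ⟨reflect z, by rwa [mem_preimage, reflect_reflect]⟩
  obtain ⟨M, hM, C, hC, hcone⟩ := exists_left_cone_of_K_lt_top hconv' hcomp' hint' hp hpt
    (ne_top_of_le_ne_top hK (K_preimage_reflect_le p Ω))
  refine ⟨M, hM, reflect C, hC, fun z hz => ?_⟩
  have h := hcone (reflect z) (by rwa [mem_preimage, reflect_reflect])
  simp only [reflect_apply] at h ⊢
  rwa [show -C.1 - z.1 = -z.1 - C.1 by ring]

end ConcaveGradient

/-! ### The equivalence. -/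

theorem theorem6 (p : ℝ≥0∞) (hp : 1 < p) (hp_top : p < ∞)
    (Ω : Set (ℝ × ℝ)) (hconv : Convex ℝ Ω) (hcomp : IsCompact Ω) (hint : (interior Ω).Nonempty) :
    ConcaveGradient.K p Ω < ∞ ↔
      ∀ a : ℝ, ConcaveGradient.IsSupportLine Ω (ConcaveGradient.verticalLine a) →
        ConcaveGradient.IsAngular Ω (ConcaveGradient.verticalLine a) := by
  have hne := hint.mono interior_subset
  constructor
  · intro hK a ha
    obtain ⟨⟨z, hz, rfl⟩, hside⟩ := ha.side
    rcases hside with hside | hside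
    · obtain ⟨M, hM, C, hC, hcone⟩ := ConcaveGradient.exists_left_cone_of_K_lt_top hconv hcomp hint
        hp hp_top.ne hK.ne
      have h1 : C.1 ≤ z.1 := by
        have := (abs_nonneg _).trans (hcone z hz)
        linarith [nonneg_of_mul_nonneg_right this hM]
      -- The cone opens to the right from `C ∈ Ω`, so `C` is a leftmost point and the given support
      -- line passes through it.
      rw [le_antisymm (hside C hC) h1]
      refine ConcaveGradient.isAngular_of_cone (η := C.2) (σ := 1) hM one_ne_zero hC fun w hw => ?_
      simpa using hcone w hw
    · obtain ⟨M, hM, C, hC, hcone⟩ := ConcaveGradient.exists_right_cone_of_K_lt_top hconv hcomp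
        hint hp hp_top.ne hK.ne
      have h1 : z.1 ≤ C.1 := by
        have := (abs_nonneg _).trans (hcone z hz)
        linarith [nonneg_of_mul_nonneg_right this hM]
      rw [le_antisymm h1 (hside C hC)]
      refine ConcaveGradient.isAngular_of_cone (η := C.2) (σ := -1) hM (by norm_num) hC
        fun w hw => ?_
      simpa using hcone w hw
  · intro hang
    obtain ⟨A, hA, hAmin⟩ := hcomp.exists_isMinOn hne continuous_fst.continuousOn
    obtain ⟨B, hB, hBmax⟩ := hcomp.exists_isMaxOn hne continuous_fst.continuousOn
    rw [isMinOn_iff] at hAmin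
    rw [isMaxOn_iff] at hBmax
    obtain ⟨M₁, hM₁, η, hη, hcA⟩ := (hang A.1 (ConcaveGradient.isSupportLine_verticalLine
      (σ := -1) (by norm_num) (fun z hz => by linarith [hAmin z hz]) ⟨A, hA, rfl⟩)).exists_cone
    obtain ⟨M₂, hM₂, θ, hθ, hcB⟩ := (hang B.1 (ConcaveGradient.isSupportLine_verticalLine
      (σ := 1) one_ne_zero (fun z hz => by linarith [hBmax z hz]) ⟨B, hB, rfl⟩)).exists_cone
    exact ConcaveGradient.K_lt_top_of_cones (M := max M₁ M₂) hconv hcomp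
      (hM₁.trans (le_max_left _ _)) hAmin hBmax hη
      (fun z hz => (hcA z hz).trans (mul_le_mul_of_nonneg_right (le_max_left _ _) (abs_nonneg _)))
      hθ
      (fun z hz => (hcB z hz).trans (mul_le_mul_of_nonneg_right (le_max_right _ _) (abs_nonneg _)))
      hp.le hp_top.ne
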